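/- All vector spaces are over $\mathbb{Q}$. For a graded vector space $W=\bigoplus_{n\ge 0}W^n$ let $\Lambda W$ denote the free graded commutative algebra on $W$, with $\Lambda^{\ge 2}W$ the span of all products of at least two elements of $W$. A (1-connected Sullivan) minimal model is a commutative differential graded algebra $(\Lambda W,d)$, with $d$ a graded derivation of degree $+1$ and $d^2=0$, such that $W$ is concentrated in degrees $\ge 2$ and $d(W)\subseteq\Lambda^{\ge 2}W$. It is called elliptic if $W$ and the cohomology $H(\Lambda W,d)$ are both finite-dimensional. It is two-stage, and is then written $\Lambda(U,V)$, if $W=U\oplus V$ for graded subspaces $U,V\subseteq W$ with $d(U)=0$ and $d(V)\subseteq\Lambda U$. **Theorem.** Let $\Lambda(U,V)$ be any elliptic two-stage minimal model, and let $U^{\mathrm{even}}$ be the part of $U$ of even degree. Then $$\dim H\bigl(\Lambda(U,V)\bigr)\;\ge\;2^{\,\dim V-\dim U^{\mathrm{even}}}.$$ -/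

import Mathlib

noncomputable section

/-- The relations `x y = (-1)^{|x||y|} y x`, for homogeneous `x`, `y` in the graded vector space `W`,
imposed on the tensor algebra of `W`. -/
inductive GradedCommRel {W : Type*} [AddCommGroup W] [Module ℚ W] (𝒲 : ℕ → Submodule ℚ W) :
    TensorAlgebra ℚ W → TensorAlgebra ℚ W → Prop
  | swap {i j : ℕ} {x y : W} (hx : x ∈ 𝒲 i) (hy : y ∈ 𝒲 j) :
      GradedCommRel 𝒲 (TensorAlgebra.ι ℚ x * TensorAlgebra.ι ℚ y)
        ((-1 : ℚ) ^ (i * j) • (TensorAlgebra.ι ℚ y * TensorAlgebra.ι ℚ x))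

/-- The free graded commutative algebra `ΛW` on the graded rational vector space `W = ⨁ₙ 𝒲 n`. -/
def FreeGCA {W : Type*} [AddCommGroup W] [Module ℚ W] (𝒲 : ℕ → Submodule ℚ W) : Type _ :=
  RingQuot (GradedCommRel 𝒲)

namespace FreeGCA

variable {W : Type*} [AddCommGroup W] [Module ℚ W] (𝒲 : ℕ → Submodule ℚ W)

instance instRing : Ring (FreeGCA 𝒲) := inferInstanceAs (Ring (RingQuot (GradedCommRel 𝒲)))

instance instAlgebra : Algebra ℚ (FreeGCA 𝒲) :=
  inferInstanceAs (Algebra ℚ (RingQuot (GradedCommRel 𝒲)))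

/-- The quotient map from the tensor algebra of `W` onto `ΛW`. -/
def mk : TensorAlgebra ℚ W →ₐ[ℚ] FreeGCA 𝒲 := RingQuot.mkAlgHom ℚ (GradedCommRel 𝒲)

/-- The canonical map `W → ΛW`. -/
def ι : W →ₗ[ℚ] FreeGCA 𝒲 := (mk 𝒲).toLinearMap ∘ₗ TensorAlgebra.ι ℚ

/-- The degree `n` part `(ΛW)ⁿ`, spanned by the products `w₁ ⋯ wₖ` (`k ≥ 0`) of homogeneous elements
of `W` whose degrees add up to `n`. -/
def degreePart (n : ℕ) : Submodule ℚ (FreeGCA 𝒲) :=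
  Submodule.span ℚ {a | ∃ l : List (Σ i : ℕ, 𝒲 i),
    (l.map fun w => w.1).sum = n ∧ (l.map fun w => ι 𝒲 (w.2 : W)).prod = a}

/-- The decomposable elements `Λ^{≥2} W = ∑_{k ≥ 2} Λᵏ W`, where `Λᵏ W` is spanned by the `k`-fold
products of elements of `W`. -/
def decomposables : Submodule ℚ (FreeGCA 𝒲) :=
  ⨆ (k : ℕ) (_ : 2 ≤ k), LinearMap.range (ι 𝒲) ^ k

/-- The subalgebra `ΛU` of `ΛW` generated by a subspace `U` of `W`. -/
def sub (U : Submodule ℚ W) : Subalgebra ℚ (FreeGCA 𝒲) :=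
  Algebra.adjoin ℚ (ι 𝒲 '' (U : Set W))

end FreeGCA

section Models

variable {W : Type*} [AddCommGroup W] [Module ℚ W] (𝒲 : ℕ → Submodule ℚ W)

/-- `d` makes `ΛW` a (cochain) commutative differential graded algebra: it has degree `+1`, is a
graded derivation, and squares to zero. -/
structure IsCDGADifferential (d : FreeGCA 𝒲 →ₗ[ℚ] FreeGCA 𝒲) : Prop where
  degree : ∀ n, ∀ a ∈ FreeGCA.degreePart 𝒲 n, d a ∈ FreeGCA.degreePart 𝒲 (n + 1)
  leibniz : ∀ n, ∀ a ∈ FreeGCA.degreePart 𝒲 n, ∀ b : FreeGCA 𝒲,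
    d (a * b) = d a * b + (-1 : ℚ) ^ n • (a * d b)
  sq_zero : ∀ a, d (d a) = 0

/-- `(ΛW, d)` is a 1-connected Sullivan minimal algebra: `W` is concentrated in degrees at least
two, and `d w` has no linear term for `w ∈ W`. -/
structure IsMinimalModel (d : FreeGCA 𝒲 →ₗ[ℚ] FreeGCA 𝒲) : Prop
    extends IsCDGADifferential 𝒲 d where
  connected : ∀ n < 2, 𝒲 n = ⊥
  minimal : ∀ w : W, d (FreeGCA.ι 𝒲 w) ∈ FreeGCA.decomposables 𝒲

/-- The total cohomology `H(ΛW, d) = ker d / im d`, where `im d` is intersected with `ker d`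
(which contains it whenever `d ∘ d = 0`). -/
abbrev ModelCohomology (d : FreeGCA 𝒲 →ₗ[ℚ] FreeGCA 𝒲) : Type _ :=
  LinearMap.ker d ⧸ (LinearMap.range d).submoduleOf (LinearMap.ker d)

/-- Both `W` and `H(ΛW, d)` are finite-dimensional. -/
structure IsEllipticModel (d : FreeGCA 𝒲 →ₗ[ℚ] FreeGCA 𝒲) : Prop where
  finite_generators : Module.Finite ℚ W
  finite_cohomology : Module.Finite ℚ (ModelCohomology 𝒲 d)

/-- `W = U ⊕ V` as graded vector spaces, with `d U = 0` and `d V ⊆ ΛU`. -/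
structure IsTwoStage [DirectSum.Decomposition 𝒲] (d : FreeGCA 𝒲 →ₗ[ℚ] FreeGCA 𝒲)
    (U V : Submodule ℚ W) : Prop where
  homogeneous_left : U.IsHomogeneous 𝒲
  homogeneous_right : V.IsHomogeneous 𝒲
  isCompl : IsCompl U V
  d_left : ∀ u ∈ U, d (FreeGCA.ι 𝒲 u) = 0
  d_right : ∀ v ∈ V, d (FreeGCA.ι 𝒲 v) ∈ FreeGCA.sub 𝒲 U

/-- The even-degree part `U^even` of a graded subspace `U` of `W`. -/
def evenPart (U : Submodule ℚ W) : Submodule ℚ W :=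
  U ⊓ ⨆ (n : ℕ) (_ : Even n), 𝒲 n

end Models

end

/-!
Write `ΛW = Λ(U, V)` for the two-stage model. The proof compares it with the total rank inequality
for modules of finite length over a polynomial ring, by way of quotients of `ΛW` by generators.

**Even generators of `U`.** An even `x ∈ U` is a central cocycle and a nonzerodivisor, so the long
exact sequence of `0 → ΛW → ΛW → ΛW / x → 0` shows that dividing by `x` at most doubles the dimension
of the cohomology. After `dim U^even` steps the cohomology has dimension at most
`2 ^ dim U^even * dim H(ΛW)` (`FreeGCA.cohomologyBoundMod_even`), and it remains to show that this
dimension is at least `2 ^ dim V`.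

**The generators of `V` are odd.** For an odd `z ∈ U` there is an exact sequence
`0 → ΛW / z → ΛW → ΛW / z → 0`, whose connecting map is induced by the commutator of `d` with the
contraction dual to `z`. By minimality this commutator increases word length in `U`, so it is
nilpotent once the even generators of `U` are gone (`FreeGCA.commutator_pow_mem`). Finiteness of the
cohomology therefore passes to `ΛW / z`, and finally to `ΛW / (U) = ΛV`, which has zero
differential. Hence `ΛV` is finite-dimensional and `V` is odd (`FreeGCA.right_le_oddGenerators`).

**The total rank inequality.** What is left is `L ⊗ N` with `L = ΛV` and `N = ΛU^odd`, both
finite-dimensional, and a differential `D = ∑ ιₖ ⊗ yₖ` built from contractions `ιₖ`, which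
anticommute, and multiplications `yₖ`, which commute and are nilpotent. On `L ⊗ N ⊗ N` consider
`D₂ = ∑ ιₖ ⊗ (yₖ ⊗ 1 - 1 ⊗ yₖ)`. The interchange of the two factors `N` anticommutes with `D₂`, so
the cohomology of `D₂` has dimension at least the trace of the interchange, namely `dim L * dim N`.
On the other hand the last factor has a filtration by submodules on whose successive quotients all
`yₖ` vanish, so the same dimension is at most `dim N` times that of the cohomology of `D`. Thus the
cohomology of `D` has dimension at least `dim L = 2 ^ dim V`
(`CohomologyBoundMod.finrank_le_of_anticommute`). This is M. Walker's argument for the total rank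
conjecture, with Koszul complexes in place of resolutions.
-/

noncomputable section

open Module

/-! ### Cohomology modulo a subspace -/

section Homological

variable {K C : Type*} [Field K] [AddCommGroup C] [Module K C]

/-- The cohomology of the complex `C / I` induced by the endomorphism `d` of `C` has dimension at
most `n`: the elements of `C` that are cocycles modulo `I` lie, up to `I` and the boundaries, in a
subspace of dimension at most `n`. Subspaces of `C` are used in place of the quotient `C / I`. -/
def CohomologyBoundMod (d : C →ₗ[K] C) (I : Submodule K C) (n : ℕ) : Prop :=
  ∃ S : Submodule K C, FiniteDimensional K S ∧ finrank K S ≤ n ∧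
    I.comap d ≤ I ⊔ LinearMap.range d ⊔ S

/-- A finite-dimensional space of elements that are related to something by a linear relation `R`
admits a space of witnesses of no larger dimension. -/
theorem exists_submodule_of_linear_relation {M N : Type*} [AddCommGroup M] [Module K M]
    [AddCommGroup N] [Module K N] (R : Submodule K (N × M)) (S : Submodule K N)
    [FiniteDimensional K S] :
    ∃ T : Submodule K M, FiniteDimensional K T ∧ finrank K T ≤ finrank K S ∧
      ∀ s ∈ S, ∀ m, (s, m) ∈ R → ∃ t ∈ T, (s, t) ∈ R := by
  let S₀ : Submodule K N := S ⊓ R.map (LinearMap.fst K N M)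
  let R₀ : Submodule K (N × M) := R ⊓ S.comap (LinearMap.fst K N M)
  let f : R₀ →ₗ[K] S₀ := ((LinearMap.fst K N M).comp R₀.subtype).codRestrict S₀ (by
    rintro ⟨x, hx⟩
    exact ⟨hx.2, x, hx.1, rfl⟩)
  have hf : Function.Surjective f := by
    rintro ⟨s, hs, x, hx, rfl⟩
    exact ⟨⟨x, hx, hs⟩, rfl⟩
  obtain ⟨g, hg⟩ := f.exists_rightInverse_of_surjective (LinearMap.range_eq_top.2 hf)
  have : FiniteDimensional K S₀ := Submodule.finiteDimensional_of_le inf_le_left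
  let h : S₀ →ₗ[K] M := (LinearMap.snd K N M).comp (R₀.subtype.comp g)
  refine ⟨LinearMap.range h, inferInstance,
    (LinearMap.finrank_range_le h).trans (Submodule.finrank_mono inf_le_left), ?_⟩
  intro s hs m hm
  let s₀ : S₀ := ⟨s, hs, _, hm, rfl⟩
  refine ⟨h s₀, ⟨s₀, rfl⟩, ?_⟩
  have h1 : ((g s₀ : R₀) : N × M).1 = s := congrArg Subtype.val (LinearMap.congr_fun hg s₀)
  have h2 : ((g s₀ : R₀) : N × M) = (s, h s₀) := Prod.ext h1 rfl
  rw [← h2]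
  exact (g s₀).2.1

/-- Dividing a complex by the image of an injective chain endomorphism `X` at most doubles the
dimension of its cohomology. -/
theorem CohomologyBoundMod.sup_range {d X : C →ₗ[K] C} {I : Submodule K C} {n : ℕ}
    (hd : ∀ c, d (d c) = 0) (hdX : ∀ c, d (X c) = X (d c)) (hdI : I ≤ I.comap d)
    (hXI : I ≤ I.comap X) (hinj : ∀ c, X c ∈ I → c ∈ I) (h : CohomologyBoundMod d I n) :
    CohomologyBoundMod d (I ⊔ LinearMap.range X) (2 * n) := by
  obtain ⟨S, hS, hSn, hSd⟩ := h
  obtain ⟨T, hT, hTS, hTR⟩ := exists_submodule_of_linear_relation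
    (I.comap (X.comp (LinearMap.fst K C C) - d.comp (LinearMap.snd K C C))) S
  refine ⟨S ⊔ T, inferInstance, ?_, ?_⟩
  · have := Submodule.finrank_add_le_finrank_add_finrank S T
    omega
  intro c hc
  obtain ⟨i, hi, _, ⟨e, rfl⟩, hie⟩ := Submodule.mem_sup.1 (Submodule.mem_comap.1 hc)
  have hde : d e ∈ I := by
    apply hinj
    have h1 : X (d e) = - d i := by
      rw [← hdX, eq_neg_iff_add_eq_zero, add_comm, ← map_add, hie, hd]
    rw [h1]
    exact I.neg_mem (hdI hi)
  obtain ⟨_, h1, s, hs, hes⟩ := Submodule.mem_sup.1 (hSd hde)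
  obtain ⟨i', hi', _, ⟨p, rfl⟩, rfl⟩ := Submodule.mem_sup.1 h1
  have hXs : X s - d (c - X p) ∈ I := by
    have h2 : X s - d (c - X p) = - (i + X i') := by
      rw [map_sub, ← hie, ← hes, hdX, map_add, map_add]; abel
    rw [h2]
    exact I.neg_mem (I.add_mem hi (hXI hi'))
  obtain ⟨t, ht, hst⟩ := hTR s hs (c - X p) (by simpa using hXs)
  have hst : X s - d t ∈ I := by simpa using hst
  have h3 : c - X p - t ∈ I ⊔ LinearMap.range d ⊔ S := hSd (by
    have h4 : d (c - X p - t) = (X s - d t) - (X s - d (c - X p)) := by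
      rw [map_sub d _ t]; abel
    rw [Submodule.mem_comap, h4]
    exact I.sub_mem hst hXs)
  have h5 : c = (c - X p - t) + (X p + t) := by abel
  rw [h5]
  refine Submodule.add_mem _ ?_ (Submodule.add_mem _ ?_ ?_)
  · exact (sup_le_sup (sup_le_sup_right le_sup_left _) le_sup_left : I ⊔ LinearMap.range d ⊔ S ≤ _) h3
  · exact Submodule.mem_sup_left (Submodule.mem_sup_left (Submodule.mem_sup_right ⟨p, rfl⟩))
  · exact Submodule.mem_sup_right (Submodule.mem_sup_right ht)

/-- Dividing by a family of even cocycles `X i`: the operators `δ i` play the role of the partial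
derivatives with respect to the `X i`, and force the `X i` to form a regular sequence. -/
theorem CohomologyBoundMod.iSup_range [CharZero K] {ι : Type*} [DecidableEq ι] {d : C →ₗ[K] C}
    {X δ : ι → C →ₗ[K] C} {n : ℕ} (hd : ∀ c, d (d c) = 0)
    (hdX : ∀ i c, d (X i c) = X i (d c)) (hXX : ∀ i j c, X i (X j c) = X j (X i c))
    (hδX : ∀ i j c, δ i (X j c) = X j (δ i c) + if i = j then c else 0)
    (hδ : ∀ i c, ∃ m : ℕ, (δ i ^ m) c = 0) (h : CohomologyBoundMod d ⊥ n) (s : Finset ι) :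
    CohomologyBoundMod d (⨆ i ∈ s, LinearMap.range (X i)) (2 ^ s.card * n) := by
  induction s using Finset.induction_on with
  | empty => simpa using h
  | insert i s his ih =>
    have key : ∀ f : C →ₗ[K] C, (∀ j ∈ s, ∀ c, f (X j c) = X j (f c)) →
        (⨆ j ∈ s, LinearMap.range (X j)) ≤ (⨆ j ∈ s, LinearMap.range (X j)).comap f := by
      intro f hf
      refine iSup₂_le fun j hj => ?_
      rintro _ ⟨c, rfl⟩
      rw [Submodule.mem_comap, hf j hj]
      exact Submodule.mem_iSup_of_mem j (Submodule.mem_iSup_of_mem hj ⟨_, rfl⟩)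
    have hδI := key (δ i) fun j hj c => by
      rw [hδX, if_neg (by rintro rfl; exact his hj), add_zero]
    have hXI := key (X i) fun j _ c => hXX i j c
    rw [Finset.iSup_insert, sup_comm, Finset.card_insert_of_notMem his, pow_succ', mul_assoc]
    refine ih.sup_range hd (hdX i) (key d fun j _ c => hdX j c) hXI fun c hc => ?_
    set I := ⨆ j ∈ s, LinearMap.range (X j)
    -- modulo `I`: if `X c = 0` and `m > 0` is minimal with `δᵐ c = 0`, then
    -- `0 = δᵐ (X c) = m δᵐ⁻¹ c`, which contradicts the minimality of `m`
    have hpow : ∀ m : ℕ, ∀ c, (δ i ^ m) (X i c) = X i ((δ i ^ m) c) + (m : K) • (δ i ^ (m - 1)) c := by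
      intro m
      induction m with
      | zero => intro c; simp
      | succ m ihm =>
        intro c
        rw [pow_succ, Module.End.mul_apply, hδX, if_pos rfl, map_add, ihm]
        rcases m with _ | m
        · simp
        · simp only [Nat.add_sub_cancel, pow_succ, Module.End.mul_apply]
          push_cast
          module
    have hpowI : ∀ m : ℕ, ∀ a ∈ I, (δ i ^ m) a ∈ I := by
      intro m
      induction m with
      | zero => intro a ha; simpa using ha
      | succ m ihm => intro a ha; rw [pow_succ, Module.End.mul_apply]; exact ihm _ (hδI ha)
    have hex : ∃ m : ℕ, (δ i ^ m) c ∈ I := by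
      obtain ⟨m, hm⟩ := hδ i c
      exact ⟨m, hm ▸ I.zero_mem⟩
    classical
    have hfind := Nat.find_spec hex
    rcases hm : Nat.find hex with _ | m
    · rw [hm] at hfind; simpa using hfind
    · rw [hm] at hfind
      exfalso
      refine Nat.find_min hex (m := m) (by omega) ?_
      have h1 := hpowI (m + 1) _ hc
      rw [hpow, Nat.add_sub_cancel] at h1
      have h2 := (I.add_mem_iff_right (hXI hfind)).1 h1
      exact (I.smul_mem_iff (by exact_mod_cast Nat.succ_ne_zero m)).1 h2

/-- Dividing by an odd cocycle `z`, provided that the connecting homomorphism, which is induced by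
`δ d + d δ`, is nilpotent: an endomorphism with finite-dimensional kernel and a vanishing power
acts on a finite-dimensional space. -/
theorem CohomologyBoundMod.sup_range_of_nilpotent {d z δ : C →ₗ[K] C} {I : Submodule K C}
    {n m : ℕ} (hd : ∀ c, d (d c) = 0) (hdz : ∀ c, d (z c) = - z (d c))
    (hδz : ∀ c, δ (z c) = c - z (δ c)) (hzz : ∀ c, z (z c) = 0)
    (hdI : I ≤ I.comap d) (hzI : I ≤ I.comap z) (hδI : I ≤ I.comap δ)
    (hnil : ∀ c, ((δ ∘ₗ d + d ∘ₗ δ) ^ m) c ∈ I ⊔ LinearMap.range z)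
    (h : CohomologyBoundMod d I n) :
    ∃ n', CohomologyBoundMod d (I ⊔ LinearMap.range z) n' := by
  set θ : C →ₗ[K] C := δ ∘ₗ d + d ∘ₗ δ with hθ
  set I' := I ⊔ LinearMap.range z with hI'
  set B := I' ⊔ LinearMap.range d with hB
  have θ_apply : ∀ c, θ c = δ (d c) + d (δ c) := fun c => rfl
  have hzI' : ∀ c, z c ∈ I' := fun c => Submodule.mem_sup_right ⟨c, rfl⟩
  have hII' : I ≤ I' := le_sup_left
  have hI'B : I' ≤ B := le_sup_left
  have hdB : ∀ c, d c ∈ B := fun c => Submodule.mem_sup_right ⟨c, rfl⟩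
  have hdI' : ∀ c ∈ I', d c ∈ I' := by
    intro c hc
    obtain ⟨i, hi, _, ⟨e, rfl⟩, rfl⟩ := Submodule.mem_sup.1 hc
    rw [map_add, hdz]
    exact I'.add_mem (hII' (hdI hi)) (I'.neg_mem (hzI' _))
  have hθz : ∀ c, θ (z c) = z (θ c) := by
    intro c
    simp only [θ_apply, hδz, hdz, map_neg, map_add, map_sub]
    abel
  have hθd : ∀ c, θ (d c) = d (θ c) := by
    intro c
    simp only [θ_apply, hd, map_add, map_zero, add_zero, zero_add]
  have hθI' : ∀ c ∈ I', θ c ∈ I' := by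
    intro c hc
    obtain ⟨i, hi, _, ⟨e, rfl⟩, rfl⟩ := Submodule.mem_sup.1 hc
    rw [map_add, hθz]
    exact I'.add_mem (hII' (I.add_mem (hδI (hdI hi)) (hdI (hδI hi)))) (hzI' _)
  obtain ⟨S, hS, -, hSd⟩ := h
  have hfirst : ∀ c, d c ∈ I' → θ c ∈ B → c ∈ B ⊔ S := by
    intro c hc hθc
    obtain ⟨i, hi, _, ⟨e, rfl⟩, hie⟩ := Submodule.mem_sup.1 hc
    -- replace `c` by a representative of its class modulo `z` on which `δ` is a multiple of `z`
    set c' := c - z (δ c) with hc'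
    set e' := e + d (δ c) with he'
    have hdc' : d c' = i + z e' := by
      rw [hc', he', map_sub, hdz, ← hie, map_add]; abel
    have hδc' : δ c' = z (δ (δ c)) := by rw [hc', map_sub, hδz]; abel
    have hθc' : θ c' = δ i + (e' - z (δ e')) - z (d (δ (δ c))) := by
      rw [θ_apply, hdc', hδc', map_add, hδz, hdz]; abel
    have hθc'B : θ c' ∈ B := by
      rw [hc', map_sub, hθz]
      exact B.sub_mem hθc (hI'B (hzI' _))
    have he'B : e' ∈ B := by
      have h1 : e' = θ c' - δ i + z (δ e') + z (d (δ (δ c))) := by rw [hθc']; abel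
      rw [h1]
      exact B.add_mem (B.add_mem (B.sub_mem hθc'B (hI'B (hII' (hδI hi)))) (hI'B (hzI' _)))
        (hI'B (hzI' _))
    obtain ⟨_, h1, _, ⟨p, rfl⟩, hep⟩ := Submodule.mem_sup.1 he'B
    obtain ⟨i₂, hi₂, _, ⟨q, rfl⟩, rfl⟩ := Submodule.mem_sup.1 h1
    have h2 : d (c' + z p) = i + z i₂ := by
      rw [map_add, hdc', ← hep, hdz, map_add, map_add, hzz]; abel
    have h3 : c' + z p ∈ I ⊔ LinearMap.range d ⊔ S := hSd (by
      rw [Submodule.mem_comap, h2]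
      exact I.add_mem hi (hzI hi₂))
    have h4 : c = (c' + z p) + z (δ c - p) := by rw [hc', map_sub]; abel
    rw [h4]
    refine Submodule.add_mem _ ?_ (Submodule.mem_sup_left (hI'B (hzI' _)))
    exact (sup_le_sup_right (sup_le_sup_right le_sup_left _) _ : I ⊔ LinearMap.range d ⊔ S ≤ _) h3
  have hall : ∀ k : ℕ, ∃ S' : Submodule K C, FiniteDimensional K S' ∧
      ∀ c, d c ∈ I' → (θ ^ k) c ∈ B → c ∈ B ⊔ S' := by
    intro k
    induction k with
    | zero => exact ⟨⊥, inferInstance, fun c _ hc => by simpa using hc⟩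
    | succ k ih =>
      obtain ⟨S', hS', hS'd⟩ := ih
      obtain ⟨T, hT, -, hTR⟩ := exists_submodule_of_linear_relation
        (B.comap (θ.comp (LinearMap.snd K C C) - LinearMap.fst K C C) ⊓
          I'.comap (d.comp (LinearMap.snd K C C))) S'
      refine ⟨S ⊔ T, inferInstance, fun c hc hθc => ?_⟩
      have h1 : θ c ∈ B ⊔ S' := hS'd _ (by rw [← hθd]; exact hθI' _ hc)
        (by rwa [pow_succ, Module.End.mul_apply] at hθc)
      obtain ⟨b, hb, s, hs, hbs⟩ := Submodule.mem_sup.1 h1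
      obtain ⟨t, ht, htR⟩ := hTR s hs c ⟨by
        have : θ c - s = b := by rw [← hbs]; abel
        simpa [this] using hb, by simpa using hc⟩
      have ht1 : θ t - s ∈ B := by simpa using htR.1
      have ht2 : d t ∈ I' := by simpa using htR.2
      have h2 : c - t ∈ B ⊔ S := by
        refine hfirst _ (by rw [map_sub]; exact I'.sub_mem hc ht2) ?_
        have : θ (c - t) = b - (θ t - s) := by rw [map_sub, ← hbs]; abel
        rw [this]
        exact B.sub_mem hb ht1
      have h3 : c = (c - t) + t := by abel
      rw [h3]
      exact Submodule.add_mem _ ((sup_le_sup_left le_sup_left _ : B ⊔ S ≤ _) h2)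
        (Submodule.mem_sup_right (Submodule.mem_sup_right ht))
  obtain ⟨S', hS', hS'd⟩ := hall m
  exact ⟨finrank K S', S', hS', le_rfl, fun c hc => hS'd c hc (hI'B (hnil c))⟩

/-- Dividing by a family of odd cocycles `z i`: the operators `δ i` play the role of the
contractions dual to the `z i`. -/
theorem CohomologyBoundMod.sup_iSup_range_of_nilpotent {ι : Type*} [DecidableEq ι]
    {d : C →ₗ[K] C} {z δ : ι → C →ₗ[K] C} {I : Submodule K C} {n m : ℕ} (hd : ∀ c, d (d c) = 0)
    (hdz : ∀ i c, d (z i c) = - z i (d c)) (hzz : ∀ i j c, z i (z j c) = - z j (z i c))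
    (hzz0 : ∀ i c, z i (z i c) = 0)
    (hδz : ∀ i j c, δ i (z j c) = (if i = j then c else 0) - z j (δ i c))
    (hdI : I ≤ I.comap d) (hzI : ∀ i, I ≤ I.comap (z i)) (hδI : ∀ i, I ≤ I.comap (δ i))
    (hnil : ∀ i c, ((δ i ∘ₗ d + d ∘ₗ δ i) ^ m) c ∈ I)
    (h : CohomologyBoundMod d I n) (s : Finset ι) :
    ∃ n', CohomologyBoundMod d (I ⊔ ⨆ i ∈ s, LinearMap.range (z i)) n' := by
  induction s using Finset.induction_on with
  | empty => exact ⟨n, by simpa using h⟩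
  | insert i s his ih =>
    obtain ⟨n', ih⟩ := ih
    have key : ∀ f : C →ₗ[K] C, (∀ c ∈ I, f c ∈ I) → (∀ j ∈ s, ∀ c, f (z j c) = - z j (f c)) →
        (I ⊔ ⨆ j ∈ s, LinearMap.range (z j)) ≤
          (I ⊔ ⨆ j ∈ s, LinearMap.range (z j)).comap f := by
      intro f hfI hf
      refine sup_le (fun c hc => Submodule.mem_sup_left (hfI c hc)) (iSup₂_le fun j hj => ?_)
      rintro _ ⟨c, rfl⟩
      rw [Submodule.mem_comap, hf j hj]
      exact Submodule.neg_mem _ (Submodule.mem_sup_right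
        (Submodule.mem_iSup_of_mem j (Submodule.mem_iSup_of_mem hj ⟨_, rfl⟩)))
    rw [Finset.iSup_insert, sup_comm (LinearMap.range (z i)), ← sup_assoc]
    refine ih.sup_range_of_nilpotent hd (hdz i) (fun c => by rw [hδz, if_pos rfl]) (hzz0 i)
      (key d (fun c hc => hdI hc) fun j _ c => hdz j c)
      (key (z i) (fun c hc => hzI i hc) fun j _ c => hzz i j c)
      (key (δ i) (fun c hc => hδI i hc) fun j hj c => ?_)
      (fun c => Submodule.mem_sup_left (Submodule.mem_sup_left (hnil i c)))
    rw [hδz, if_neg (by rintro rfl; exact his hj), zero_sub]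

end Homological

/-! ### The total rank inequality for twisted tensor products -/

section TotalRank

variable {K : Type*} [Field K]

/-- The cohomology of an iterated extension of `n` copies of a complex has dimension at most `n`
times that of the complex. -/
theorem CohomologyBoundMod.of_strictly_triangular {C : Type*} [AddCommGroup C] [Module K C]
    {n m : ℕ} {d : C →ₗ[K] C} {E : Fin n → Fin n → C →ₗ[K] C} {D : (Fin n → C) →ₗ[K] (Fin n → C)}
    (hE : ∀ i j, i ≤ j → E i j = 0) (hDE : ∀ f i, D f i = d (f i) + ∑ j, E i j (f j))
    (hD : ∀ f, D (D f) = 0) (h : CohomologyBoundMod d ⊥ m) :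
    CohomologyBoundMod D ⊥ (n * m) := by
  classical
  obtain ⟨S, hS, hSm, hSd⟩ := h
  -- the subcomplexes of functions that vanish on the first `p` indices filter the complex
  have key : ∀ q p : ℕ, p + q = n → ∃ T : Submodule K (Fin n → C), FiniteDimensional K T ∧
      finrank K T ≤ q * m ∧ ∀ f, (∀ i : Fin n, (i : ℕ) < p → f i = 0) → D f = 0 →
        f ∈ LinearMap.range D ⊔ T := by
    intro q
    induction q with
    | zero =>
      intro p hp
      refine ⟨⊥, inferInstance, by simp, fun f hf _ => ?_⟩
      have : f = 0 := funext fun i => hf i (by omega)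
      simp [this]
    | succ q ih =>
      intro p hp
      obtain ⟨T, hT, hTq, hTd⟩ := ih (p + 1) (by omega)
      let p' : Fin n := ⟨p, by omega⟩
      let F : ℕ → Submodule K (Fin n → C) := fun p =>
        { carrier := {f | ∀ i : Fin n, (i : ℕ) < p → f i = 0}
          add_mem' := fun {f g} hf hg i hi => by rw [Pi.add_apply, hf i hi, hg i hi, add_zero]
          zero_mem' := fun i _ => rfl
          smul_mem' := fun c f hf i hi => by rw [Pi.smul_apply, hf i hi, smul_zero] }
      let S₁ := S.map (LinearMap.single K (fun _ : Fin n => C) p')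
      have hS₁ : finrank K S₁ ≤ m := (Submodule.finrank_map_le _ _).trans hSm
      obtain ⟨T₁, hT₁, hT₁S, hTR⟩ := exists_submodule_of_linear_relation
        ((F p).comap (LinearMap.snd K _ _) ⊓ (LinearMap.ker D).comap (LinearMap.snd K _ _) ⊓
          (F (p + 1) ⊔ LinearMap.range D).comap
            (LinearMap.fst K (Fin n → C) (Fin n → C) - LinearMap.snd K _ _)) S₁
      refine ⟨T₁ ⊔ T, inferInstance, ?_, fun f hf hDf => ?_⟩
      · have := Submodule.finrank_add_le_finrank_add_finrank T₁ T
        rw [Nat.succ_mul]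
        omega
      have hdf : d (f p') = 0 := by
        have h1 := congrFun hDf p'
        rw [hDE, Finset.sum_eq_zero, add_zero] at h1
        · exact h1
        · intro j _
          rcases lt_or_ge j p' with hj | hj
          · rw [hf j hj, map_zero]
          · rw [hE _ _ hj, LinearMap.zero_apply]
      obtain ⟨_, h1, s, hs, hqs⟩ := Submodule.mem_sup.1 (hSd (by simpa using hdf : f p' ∈ _))
      rw [bot_sup_eq] at h1
      obtain ⟨q₁, rfl⟩ := h1
      have hmem : f - D (Pi.single p' q₁) - Pi.single p' s ∈ F (p + 1) := by
        intro i hi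
        rcases lt_or_eq_of_le (Nat.lt_succ_iff.1 hi) with hi | hi
        · have hne : i ≠ p' := fun h => by simp [h, p'] at hi
          rw [Pi.sub_apply, Pi.sub_apply, hf i hi, hDE, Pi.single_eq_of_ne hne,
            Pi.single_eq_of_ne hne, Finset.sum_eq_zero]
          · simp
          · intro j _
            by_cases hj : j = p'
            · rw [hE _ _ (by rw [hj]; exact Fin.le_def.2 hi.le), LinearMap.zero_apply]
            · rw [Pi.single_eq_of_ne hj, map_zero]
        · have hip : i = p' := Fin.ext hi
          rw [hip, Pi.sub_apply, Pi.sub_apply, hDE, Pi.single_eq_same, Pi.single_eq_same, ← hqs,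
            Finset.sum_eq_zero]
          · abel
          · intro j _
            by_cases hj : j = p'
            · rw [hE _ _ (by rw [hj]), LinearMap.zero_apply]
            · rw [Pi.single_eq_of_ne hj, map_zero]
      obtain ⟨t, ht, ⟨⟨ht1, ht2⟩, ht3⟩⟩ := hTR (Pi.single p' s) ⟨s, hs, rfl⟩ f
        ⟨⟨hf, hDf⟩, by
          have h2 : Pi.single p' s - f = -(f - D (Pi.single p' q₁) - Pi.single p' s)
            + D (Pi.single p' (-q₁)) := by rw [Pi.single_neg, map_neg]; abel
          change Pi.single p' s - f ∈ F (p + 1) ⊔ LinearMap.range D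
          rw [h2]
          exact Submodule.add_mem _ (Submodule.mem_sup_left (Submodule.neg_mem _ hmem))
            (Submodule.mem_sup_right ⟨_, rfl⟩)⟩
      have ht2 : D t = 0 := by simpa using ht2
      obtain ⟨g, hg, _, ⟨r, rfl⟩, hgr⟩ := Submodule.mem_sup.1 ht3
      simp only [LinearMap.sub_apply, LinearMap.fst_apply, LinearMap.snd_apply] at hgr
      have h3 : f - t - D (Pi.single p' q₁ + r) =
          (f - D (Pi.single p' q₁) - Pi.single p' s) + g := by
        have : g = Pi.single p' s - t - D r := by rw [← hgr]; abel
        rw [this, map_add]; abel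
      have h4 := hTd (f - t - D (Pi.single p' q₁ + r))
        (by rw [h3]; exact (F (p + 1)).add_mem hmem hg) (by rw [map_sub, map_sub, hDf, ht2, hD]; simp)
      have h5 : f = (f - t - D (Pi.single p' q₁ + r)) + (D (Pi.single p' q₁ + r) + t) := by abel
      rw [h5]
      refine Submodule.add_mem _ ((sup_le_sup_left le_sup_right _ : LinearMap.range D ⊔ T ≤ _) h4)
        (Submodule.add_mem _ (Submodule.mem_sup_left ⟨_, rfl⟩)
          (Submodule.mem_sup_right (Submodule.mem_sup_left ht)))
  obtain ⟨T, hT, hTn, hTd⟩ := key n 0 (by omega)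
  refine ⟨T, hT, hTn, fun f hf => ?_⟩
  rw [bot_sup_eq]
  exact hTd f (fun i hi => absurd hi (Nat.not_lt_zero _)) (by simpa using hf)

/-- A differential that maps one of two complementary subspaces into the other has rank at most
the dimension of the latter. -/
theorem finrank_range_le_of_map_le {C : Type*} [AddCommGroup C] [Module K C]
    [FiniteDimensional K C] {D : C →ₗ[K] C} (hD : ∀ c, D (D c) = 0) {P N : Submodule K C}
    (hPN : P ⊔ N = ⊤) (hP : P.map D ≤ N) : finrank K (LinearMap.range D) ≤ finrank K N := by
  rw [LinearMap.range_eq_map, ← hPN, Submodule.map_sup]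
  refine (Submodule.finrank_add_le_finrank_add_finrank _ _).trans ?_
  have h1 := LinearMap.finrank_range_add_finrank_ker (D.domRestrict N)
  rw [LinearMap.range_domRestrict] at h1
  have h2 : finrank K (P.map D) ≤ finrank K (LinearMap.ker (D.domRestrict N)) := by
    let g : P.map D →ₗ[K] LinearMap.ker (D.domRestrict N) :=
      (Submodule.inclusion hP).codRestrict _ (by
        rintro ⟨_, c, hc, rfl⟩
        exact hD c)
    refine LinearMap.finrank_le_finrank_of_injective (f := g) fun x y hxy => ?_
    exact Subtype.ext (congrArg
      (fun z : LinearMap.ker (D.domRestrict N) => ((z : N) : C)) hxy)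
  omega

/-- The symmetric square argument: on the functions of two indices, a differential that
anticommutes with the swap of the indices has cohomology of dimension at least the trace of the
swap, which is the dimension of the space of functions on the diagonal. -/
theorem CohomologyBoundMod.mul_finrank_le_of_swap [CharZero K] {L : Type*} [AddCommGroup L]
    [Module K L] [FiniteDimensional K L] {n N : ℕ}
    {D : (Fin n → Fin n → L) →ₗ[K] (Fin n → Fin n → L)} (hD : ∀ f, D (D f) = 0)
    (hswap : ∀ f i j, D (fun a b => f b a) i j = - D f j i) (h : CohomologyBoundMod D ⊥ N) :
    n * finrank K L ≤ N := by
  obtain ⟨S, hS, hSN, hSD⟩ := h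
  let P : Submodule K (Fin n → Fin n → L) :=
    { carrier := {f | ∀ i j, f j i = f i j}
      add_mem' := fun {f g} hf hg i j => by simp only [Pi.add_apply, hf i j, hg i j]
      zero_mem' := fun i j => rfl
      smul_mem' := fun c f hf i j => by simp only [Pi.smul_apply, hf i j] }
  let A : Submodule K (Fin n → Fin n → L) :=
    { carrier := {f | ∀ i j, f j i = - f i j}
      add_mem' := fun {f g} hf hg i j => by simp only [Pi.add_apply, hf i j, hg i j]; abel
      zero_mem' := fun i j => by simp
      smul_mem' := fun c f hf i j => by simp only [Pi.smul_apply, hf i j, smul_neg] }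
  have hPA : P ⊔ A = ⊤ := by
    refine eq_top_iff.2 fun f _ => ?_
    have h1 : f = (fun i j => (2⁻¹ : K) • (f i j + f j i)) +
        (fun i j => (2⁻¹ : K) • (f i j - f j i)) := by
      funext i j
      simp only [Pi.add_apply]
      have : (2 : K) ≠ 0 := two_ne_zero
      rw [← smul_add, show f i j + f j i + (f i j - f j i) = (2 : K) • f i j by
        rw [two_smul]; abel, smul_smul, inv_mul_cancel₀ this, one_smul]
    rw [h1]
    refine Submodule.add_mem _ (Submodule.mem_sup_left fun i j => ?_)
      (Submodule.mem_sup_right fun i j => ?_)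
    · simp only [add_comm]
    · rw [← smul_neg, neg_sub]
  have hPD : P.map D ≤ A := by
    rintro _ ⟨f, hf, rfl⟩ i j
    have h1 : (fun a b => f b a) = f := funext fun a => funext fun b => hf a b
    have h2 := hswap f i j
    rw [h1] at h2
    rw [h2, neg_neg]
  have hrank := finrank_range_le_of_map_le hD hPA hPD
  have hdim : finrank K A + finrank K A + n * finrank K L ≤
      finrank K (Fin n → Fin n → L) := by
    let g : (A × A) × (Fin n → L) →ₗ[K] (Fin n → Fin n → L) :=
      { toFun := fun x i j => if i < j then (x.1.1 : Fin n → Fin n → L) i j else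
          if j < i then (x.1.2 : Fin n → Fin n → L) i j else x.2 i
        map_add' := fun x y => by
          funext i j
          simp only [Pi.add_apply]
          split_ifs <;> simp
        map_smul' := fun c x => by
          funext i j
          simp only [Pi.smul_apply]
          split_ifs <;> simp }
    have hg : Function.Injective g := by
      rw [← LinearMap.ker_eq_bot, LinearMap.ker_eq_bot']
      rintro ⟨⟨a, b⟩, k⟩ h0
      have h0 : ∀ i j, (if i < j then (a : Fin n → Fin n → L) i j else
          if j < i then (b : Fin n → Fin n → L) i j else k i) = 0 := fun i j =>
        congrFun (congrFun h0 i) j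
      have hdiag : ∀ x : A, ∀ i, (x : Fin n → Fin n → L) i i = 0 := fun x i => by
        have h1 : (2 : K) • (x : Fin n → Fin n → L) i i = 0 := by
          rw [two_smul, ← eq_neg_iff_add_eq_zero]
          exact x.2 i i
        exact (smul_eq_zero.1 h1).resolve_left two_ne_zero
      have ha : a = 0 := by
        refine Subtype.ext (funext fun i => funext fun j => ?_)
        rcases lt_trichotomy i j with hij | rfl | hij
        · simpa [hij] using h0 i j
        · exact hdiag a i
        · have := h0 j i
          rw [if_pos hij] at this
          rw [a.2 j i, this]
          simp
      have hb : b = 0 := by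
        refine Subtype.ext (funext fun i => funext fun j => ?_)
        rcases lt_trichotomy j i with hij | rfl | hij
        · have := h0 i j
          rw [if_neg hij.not_gt, if_pos hij] at this
          exact this
        · exact hdiag b j
        · have := h0 j i
          rw [if_neg hij.not_gt, if_pos hij] at this
          rw [b.2 j i, this]
          simp
      have hk : k = 0 := funext fun i => by simpa using h0 i i
      rw [ha, hb, hk]
      rfl
    have := LinearMap.finrank_le_finrank_of_injective hg
    simpa [Module.finrank_prod, Module.finrank_pi_fintype] using this
  have hker : finrank K (LinearMap.ker D) ≤ finrank K (LinearMap.range D) + N := by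
    have h1 : LinearMap.ker D ≤ LinearMap.range D ⊔ S := fun f hf => by
      have := hSD (show f ∈ _ by simpa using hf)
      rwa [bot_sup_eq] at this
    have h2 := Submodule.finrank_mono h1
    have h3 := Submodule.finrank_add_le_finrank_add_finrank (LinearMap.range D) S
    omega
  have := LinearMap.finrank_range_add_finrank_ker D
  omega

/-- The total rank inequality. The complex `Fin n → L` is a twisted tensor product of `L` with an
`n`-dimensional space on which the twisting terms act nilpotently, and its cohomology has dimension
at least `dim L`. It is compared with the twisted tensor product of `L` with two copies of that
space. -/
theorem CohomologyBoundMod.finrank_le_of_anticommute [CharZero K] {L : Type*} [AddCommGroup L]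
    [Module K L] [FiniteDimensional K L] {n N : ℕ} (hn : 0 < n) {E : Fin n → Fin n → L →ₗ[K] L}
    {D : (Fin n → L) →ₗ[K] (Fin n → L)} (hE : ∀ i j, i ≤ j → E i j = 0)
    (hEE : ∀ i j k l x, E i j (E k l x) = - E k l (E i j x))
    (hDE : ∀ f i, D f i = ∑ j, E i j (f j)) (hD : ∀ f, D (D f) = 0)
    (h : CohomologyBoundMod D ⊥ N) : finrank K L ≤ N := by
  -- the twisted tensor product of `L` with two copies of the space, on which the twisting terms
  -- act by the difference of their actions on the two factors
  let E' : Fin n → Fin n → (Fin n → L) →ₗ[K] (Fin n → L) := fun i j =>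
    - LinearMap.pi fun k => (E i j).comp (LinearMap.proj k)
  let D₂ : (Fin n → Fin n → L) →ₗ[K] (Fin n → Fin n → L) :=
    LinearMap.pi fun i => D.comp (LinearMap.proj i) + ∑ j, (E' i j).comp (LinearMap.proj j)
  have hD₂ : ∀ f i, D₂ f i = D (f i) + ∑ j, E' i j (f j) := fun f i => by
    simp [D₂, LinearMap.sum_apply]
  have hD₂' : ∀ f i k, D₂ f i k = ∑ j, E k j (f i j) - ∑ j, E i j (f j k) := fun f i k => by
    rw [hD₂, Pi.add_apply, hDE, Finset.sum_apply, sub_eq_add_neg, ← Finset.sum_neg_distrib]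
    rfl
  have hEsq : ∀ (f : Fin n → L) i, ∑ j, ∑ k, E i j (E j k (f k)) = 0 := fun f i => by
    have h1 := congrFun (hD f) i
    simpa only [hDE, map_sum, Pi.zero_apply] using h1
  have hD₂0 : ∀ f, D₂ (D₂ f) = 0 := fun f => by
    funext i k
    have h1 := hEsq (f i) k
    have h2 := hEsq (fun j => f j k) i
    simp only [hD₂', map_sub, map_sum, Finset.sum_sub_distrib, Pi.zero_apply, h1, h2]
    rw [Finset.sum_comm, zero_sub, sub_zero, neg_sub_left, neg_eq_zero, ← Finset.sum_add_distrib]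
    refine Finset.sum_eq_zero fun j _ => ?_
    rw [← Finset.sum_add_distrib]
    refine Finset.sum_eq_zero fun l _ => ?_
    rw [hEE]; abel
  have hbound := h.of_strictly_triangular (D := D₂) (E := E')
    (fun i j hij => by simp only [E', hE i j hij]; ext; simp) hD₂ hD₂0
  have := hbound.mul_finrank_le_of_swap hD₂0 (fun f i j => by rw [hD₂', hD₂', neg_sub])
  exact Nat.le_of_mul_le_mul_left this hn

end TotalRank

/-! ### Operators on free graded commutative algebras -/

section Generators

variable {W : Type*} [AddCommGroup W] [Module ℚ W] (𝒲 : ℕ → Submodule ℚ W)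

/-- The span of the generators of odd degree. -/
def oddGenerators : Submodule ℚ W := ⨆ (n : ℕ) (_ : Odd n), 𝒲 n

/-- The span of the generators of even degree. -/
def evenGenerators : Submodule ℚ W := ⨆ (n : ℕ) (_ : Even n), 𝒲 n

variable {𝒲}

theorem mem_evenGenerators {n : ℕ} (hn : Even n) {w : W} (hw : w ∈ 𝒲 n) : w ∈ evenGenerators 𝒲 :=
  Submodule.mem_iSup_of_mem n (Submodule.mem_iSup_of_mem hn hw)

theorem mem_oddGenerators {n : ℕ} (hn : Odd n) {w : W} (hw : w ∈ 𝒲 n) : w ∈ oddGenerators 𝒲 :=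
  Submodule.mem_iSup_of_mem n (Submodule.mem_iSup_of_mem hn hw)

theorem evenGenerators_le {S : Submodule ℚ W} (h : ∀ n, Even n → 𝒲 n ≤ S) :
    evenGenerators 𝒲 ≤ S :=
  iSup₂_le h

theorem oddGenerators_le {S : Submodule ℚ W} (h : ∀ n, Odd n → 𝒲 n ≤ S) :
    oddGenerators 𝒲 ≤ S :=
  iSup₂_le h

variable (𝒲) in
/-- The endomorphism of a graded vector space that multiplies the elements of degree `n` by
`c n`. -/
def degreeScaling [DirectSum.Decomposition 𝒲] (c : ℕ → ℚ) : W →ₗ[ℚ] W :=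
  (DirectSum.toModule ℚ ℕ W fun n => c n • (𝒲 n).subtype).comp
    (DirectSum.decomposeLinearEquiv 𝒲).toLinearMap

theorem degreeScaling_of_mem [DirectSum.Decomposition 𝒲] (c : ℕ → ℚ) {n : ℕ} {w : W}
    (hw : w ∈ 𝒲 n) : degreeScaling 𝒲 c w = c n • w := by
  lift w to 𝒲 n using hw
  simp [degreeScaling, DirectSum.toModule_lof]

theorem degreeScaling_mem [DirectSum.Decomposition 𝒲] (c : ℕ → ℚ) {U : Submodule ℚ W}
    (hU : U.IsHomogeneous 𝒲) {u : W} (hu : u ∈ U) : degreeScaling 𝒲 c u ∈ U := by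
  classical
  rw [← DirectSum.sum_support_decompose 𝒲 u, map_sum]
  refine Submodule.sum_mem _ fun n _ => ?_
  rw [degreeScaling_of_mem c (SetLike.coe_mem _)]
  exact U.smul_mem _ (hU n hu)

/-- The projection of a graded vector space onto its part of even degree. -/
abbrev evenProjection (𝒲 : ℕ → Submodule ℚ W) [DirectSum.Decomposition 𝒲] : W →ₗ[ℚ] W :=
  degreeScaling 𝒲 fun n => if Even n then 1 else 0

theorem evenProjection_of_even [DirectSum.Decomposition 𝒲] {w : W} (hw : w ∈ evenGenerators 𝒲) :
    evenProjection 𝒲 w = w := by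
  have : evenGenerators 𝒲 ≤ LinearMap.eqLocus (evenProjection 𝒲) LinearMap.id :=
    evenGenerators_le fun n hn w hw => by
      simp [LinearMap.mem_eqLocus, degreeScaling_of_mem _ hw, hn]
  exact this hw

theorem evenProjection_of_odd [DirectSum.Decomposition 𝒲] {w : W} (hw : w ∈ oddGenerators 𝒲) :
    evenProjection 𝒲 w = 0 := by
  have : oddGenerators 𝒲 ≤ LinearMap.ker (evenProjection 𝒲) :=
    oddGenerators_le fun n hn w hw => by
      simp [LinearMap.mem_ker, degreeScaling_of_mem _ hw, Nat.not_even_iff_odd.2 hn]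
  exact this hw

theorem evenProjection_mem [DirectSum.Decomposition 𝒲] (w : W) :
    evenProjection 𝒲 w ∈ evenGenerators 𝒲 ∧ w - evenProjection 𝒲 w ∈ oddGenerators 𝒲 := by
  induction w using DirectSum.Decomposition.inductionOn 𝒲 with
  | zero => simp
  | @homogeneous n w =>
    rw [degreeScaling_of_mem _ w.2]
    rcases Nat.even_or_odd n with hn | hn
    · simpa [hn] using mem_evenGenerators hn w.2
    · simpa [Nat.not_even_iff_odd.2 hn] using mem_oddGenerators hn w.2
  | add v w hv hw =>
    rw [map_add, add_sub_add_comm]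
    exact ⟨Submodule.add_mem _ hv.1 hw.1, Submodule.add_mem _ hv.2 hw.2⟩

theorem even_sup_odd [DirectSum.Decomposition 𝒲] {U : Submodule ℚ W} (hU : U.IsHomogeneous 𝒲) :
    U ⊓ evenGenerators 𝒲 ⊔ U ⊓ oddGenerators 𝒲 = U := by
  refine le_antisymm (sup_le inf_le_left inf_le_left) fun u hu => ?_
  have h1 := degreeScaling_mem (fun n => if Even n then 1 else 0) hU hu
  rw [← add_sub_cancel (evenProjection 𝒲 u) u]
  exact Submodule.add_mem _ (Submodule.mem_sup_left ⟨h1, (evenProjection_mem u).1⟩)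
    (Submodule.mem_sup_right ⟨U.sub_mem hu h1, (evenProjection_mem u).2⟩)

theorem disjoint_even_odd [DirectSum.Decomposition 𝒲] :
    Disjoint (evenGenerators 𝒲) (oddGenerators 𝒲) :=
  Submodule.disjoint_def.2 fun x he ho => by
    rw [← evenProjection_of_even he, evenProjection_of_odd ho]

/-- `W = U^even ⊕ (U^odd ⊕ V)`. -/
theorem isCompl_even_part [DirectSum.Decomposition 𝒲] {U V : Submodule ℚ W}
    (hU : U.IsHomogeneous 𝒲) (hUV : IsCompl U V) :
    IsCompl (U ⊓ evenGenerators 𝒲) (U ⊓ oddGenerators 𝒲 ⊔ V) := by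
  refine ⟨Submodule.disjoint_def.2 fun x hx hx' => ?_, codisjoint_iff.2 ?_⟩
  · obtain ⟨o, ho, v, hv, rfl⟩ := Submodule.mem_sup.1 hx'
    have hv0 : v = 0 := Submodule.disjoint_def.1 hUV.disjoint v
      (by simpa using U.sub_mem hx.1 ho.1) hv
    subst hv0
    exact Submodule.disjoint_def.1 disjoint_even_odd _ hx.2 (by simpa using ho.2)
  · rw [← sup_assoc, even_sup_odd hU, hUV.sup_eq_top]

/-- `W = U^odd ⊕ (U^even ⊕ V)`. -/
theorem isCompl_odd_part [DirectSum.Decomposition 𝒲] {U V : Submodule ℚ W}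
    (hU : U.IsHomogeneous 𝒲) (hUV : IsCompl U V) :
    IsCompl (U ⊓ oddGenerators 𝒲) (U ⊓ evenGenerators 𝒲 ⊔ V) := by
  refine ⟨Submodule.disjoint_def.2 fun x hx hx' => ?_, codisjoint_iff.2 ?_⟩
  · obtain ⟨o, ho, v, hv, rfl⟩ := Submodule.mem_sup.1 hx'
    have hv0 : v = 0 := Submodule.disjoint_def.1 hUV.disjoint v
      (by simpa using U.sub_mem hx.1 ho.1) hv
    subst hv0
    exact Submodule.disjoint_def.1 disjoint_even_odd _ (by simpa using ho.2) hx.2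
  · rw [← sup_assoc, sup_comm (U ⊓ oddGenerators 𝒲), even_sup_odd hU, hUV.sup_eq_top]

theorem even_le_sup [DirectSum.Decomposition 𝒲] {U V : Submodule ℚ W} (hU : U.IsHomogeneous 𝒲)
    (hV : V.IsHomogeneous 𝒲) (hUV : IsCompl U V) :
    evenGenerators 𝒲 ≤ U ⊓ evenGenerators 𝒲 ⊔ V := fun w hw => by
  obtain ⟨u, hu, v, hv, rfl⟩ := Submodule.mem_sup.1 (hUV.sup_eq_top ▸ Submodule.mem_top : w ∈ U ⊔ V)
  rw [← evenProjection_of_even hw, map_add]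
  exact Submodule.add_mem _
    (Submodule.mem_sup_left ⟨degreeScaling_mem _ hU hu, (evenProjection_mem u).1⟩)
    (Submodule.mem_sup_right (degreeScaling_mem _ hV hv))

theorem odd_le_sup [DirectSum.Decomposition 𝒲] {U V : Submodule ℚ W} (hU : U.IsHomogeneous 𝒲)
    (hV : V.IsHomogeneous 𝒲) (hUV : IsCompl U V) :
    oddGenerators 𝒲 ≤ U ⊓ oddGenerators 𝒲 ⊔ V := fun w hw => by
  obtain ⟨u, hu, v, hv, rfl⟩ := Submodule.mem_sup.1 (hUV.sup_eq_top ▸ Submodule.mem_top : w ∈ U ⊔ V)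
  rw [← sub_zero (u + v), ← evenProjection_of_odd hw, map_add, add_sub_add_comm]
  exact Submodule.add_mem _
    (Submodule.mem_sup_left ⟨U.sub_mem hu (degreeScaling_mem _ hU hu), (evenProjection_mem u).2⟩)
    (Submodule.mem_sup_right (V.sub_mem hv (degreeScaling_mem _ hV hv)))

/-- A basis of a subspace `R` with its dual coordinates, extended by zero to a complement `Q`. -/
theorem exists_dual_family {R Q : Submodule ℚ W} (h : IsCompl R Q) [FiniteDimensional ℚ R] :
    ∃ (x : Fin (finrank ℚ R) → W) (φ : Fin (finrank ℚ R) → W →ₗ[ℚ] ℚ),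
      (∀ i, x i ∈ R) ∧ Submodule.span ℚ (Set.range x) = R ∧
      (∀ i j, φ i (x j) = if i = j then 1 else 0) ∧ ∀ i, ∀ w ∈ Q, φ i w = 0 := by
  classical
  let b := Module.finBasis ℚ R
  refine ⟨fun i => b i, fun i => (b.coord i).comp (Submodule.projectionOnto R Q h),
    fun i => (b i).2, ?_, fun i j => ?_, fun i w hw => ?_⟩
  · have h1 := congrArg (Submodule.map R.subtype) b.span_eq
    rw [Submodule.map_span, Submodule.map_top, Submodule.range_subtype, ← Set.range_comp] at h1
    exact h1
  · rw [LinearMap.comp_apply, Submodule.projectionOnto_apply_left h (b j), Basis.coord_apply,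
      Basis.repr_self, Finsupp.single_apply]
    simp only [eq_comm]
  · rw [LinearMap.comp_apply, (Submodule.projectionOnto_apply_eq_zero_iff h).2 hw, map_zero]

end Generators

namespace FreeGCA

variable {W : Type*} [AddCommGroup W] [Module ℚ W] {𝒲 : ℕ → Submodule ℚ W}

theorem ι_mul_ι {i j : ℕ} {x y : W} (hx : x ∈ 𝒲 i) (hy : y ∈ 𝒲 j) :
    ι 𝒲 x * ι 𝒲 y = (-1 : ℚ) ^ (i * j) • (ι 𝒲 y * ι 𝒲 x) := by
  have h := RingQuot.mkAlgHom_rel ℚ (GradedCommRel.swap (𝒲 := 𝒲) hx hy)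
  rw [map_smul, map_mul, map_mul] at h
  exact h

/-- The universal property of the free graded commutative algebra. -/
def lift {B : Type*} [Ring B] [Algebra ℚ B] (f : W →ₗ[ℚ] B)
    (hf : ∀ i j, ∀ x ∈ 𝒲 i, ∀ y ∈ 𝒲 j, f x * f y = (-1 : ℚ) ^ (i * j) • (f y * f x)) :
    FreeGCA 𝒲 →ₐ[ℚ] B :=
  RingQuot.liftAlgHom ℚ ⟨TensorAlgebra.lift ℚ f, by
    rintro _ _ ⟨hx, hy⟩
    simpa using hf _ _ _ hx _ hy⟩

@[simp]
theorem lift_ι {B : Type*} [Ring B] [Algebra ℚ B] (f : W →ₗ[ℚ] B)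
    (hf : ∀ i j, ∀ x ∈ 𝒲 i, ∀ y ∈ 𝒲 j, f x * f y = (-1 : ℚ) ^ (i * j) • (f y * f x)) (w : W) :
    lift f hf (ι 𝒲 w) = f w := by
  change RingQuot.liftAlgHom ℚ _ (RingQuot.mkAlgHom ℚ _ (TensorAlgebra.ι ℚ w)) = _
  rw [RingQuot.liftAlgHom_mkAlgHom_apply, TensorAlgebra.lift_ι_apply]

/-- A subspace of `ΛW` is everything if it contains `1` and is stable under left multiplication by
the generators. -/
theorem eq_top_of_ι_mul_mem {S : Submodule ℚ (FreeGCA 𝒲)} (h1 : 1 ∈ S)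
    (hS : ∀ w, ∀ a ∈ S, ι 𝒲 w * a ∈ S) : S = ⊤ := by
  refine eq_top_iff.2 fun a _ => ?_
  obtain ⟨t, rfl⟩ : ∃ t, mk 𝒲 t = a := RingQuot.mkAlgHom_surjective ℚ _ a
  suffices ∀ t, ∀ a ∈ S, mk 𝒲 t * a ∈ S by simpa using this t 1 h1
  intro t
  induction t using TensorAlgebra.induction with
  | algebraMap r =>
    intro a ha
    rw [AlgHom.commutes, ← Algebra.smul_def]
    exact S.smul_mem r ha
  | ι w => exact fun a ha => hS w a ha
  | mul s t hs ht => intro a ha; rw [map_mul, mul_assoc]; exact hs _ (ht _ ha)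
  | add s t hs ht => intro a ha; rw [map_add, add_mul]; exact S.add_mem (hs _ ha) (ht _ ha)

theorem linearMap_ext {M : Type*} [AddCommGroup M] [Module ℚ M] {f g : FreeGCA 𝒲 →ₗ[ℚ] M}
    (h1 : f 1 = g 1) (h : ∀ w a, f a = g a → f (ι 𝒲 w * a) = g (ι 𝒲 w * a)) : f = g :=
  LinearMap.eqLocus_eq_top.1 (eq_top_of_ι_mul_mem (S := LinearMap.eqLocus f g) h1 h)

theorem ι_even_mul [DirectSum.Decomposition 𝒲] {x : W} (hx : x ∈ evenGenerators 𝒲)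
    (a : FreeGCA 𝒲) : ι 𝒲 x * a = a * ι 𝒲 x := by
  have hι : ∀ w, ι 𝒲 x * ι 𝒲 w = ι 𝒲 w * ι 𝒲 x := by
    intro w
    have : evenGenerators 𝒲 ≤ LinearMap.eqLocus
        ((LinearMap.mulRight ℚ (ι 𝒲 w)).comp (ι 𝒲)) ((LinearMap.mulLeft ℚ (ι 𝒲 w)).comp (ι 𝒲)) := by
      refine evenGenerators_le fun n hn x hx => ?_
      change ι 𝒲 x * ι 𝒲 w = ι 𝒲 w * ι 𝒲 x
      induction w using DirectSum.Decomposition.inductionOn 𝒲 with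
      | zero => simp
      | homogeneous w => rw [ι_mul_ι hx w.2, (hn.mul_right _).neg_one_pow, one_smul]
      | add v w hv hw => rw [map_add, mul_add, add_mul, hv, hw]
    exact this hx
  have h : LinearMap.mulLeft ℚ (ι 𝒲 x) = LinearMap.mulRight ℚ (ι 𝒲 x) := by
    refine linearMap_ext (by simp) fun w a ha => ?_
    have ha : ι 𝒲 x * a = a * ι 𝒲 x := ha
    change ι 𝒲 x * (ι 𝒲 w * a) = ι 𝒲 w * a * ι 𝒲 x
    rw [← mul_assoc, hι, mul_assoc, ha, mul_assoc]
  exact LinearMap.congr_fun h a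

theorem ι_odd_mul_ι_odd {x y : W} (hx : x ∈ oddGenerators 𝒲) (hy : y ∈ oddGenerators 𝒲) :
    ι 𝒲 x * ι 𝒲 y = - (ι 𝒲 y * ι 𝒲 x) := by
  have h1 : ∀ n, Odd n → ∀ x ∈ 𝒲 n, ∀ y ∈ oddGenerators 𝒲, ι 𝒲 x * ι 𝒲 y = - (ι 𝒲 y * ι 𝒲 x) := by
    intro n hn x hx y hy
    have : oddGenerators 𝒲 ≤ LinearMap.eqLocus ((LinearMap.mulLeft ℚ (ι 𝒲 x)).comp (ι 𝒲))
        (-(LinearMap.mulRight ℚ (ι 𝒲 x)).comp (ι 𝒲)) :=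
      oddGenerators_le fun m hm y hy => by
        change ι 𝒲 x * ι 𝒲 y = - (ι 𝒲 y * ι 𝒲 x)
        rw [ι_mul_ι hx hy, (hn.mul hm).neg_one_pow, neg_smul, one_smul]
    exact this hy
  have : oddGenerators 𝒲 ≤ LinearMap.eqLocus ((LinearMap.mulRight ℚ (ι 𝒲 y)).comp (ι 𝒲))
      (-(LinearMap.mulLeft ℚ (ι 𝒲 y)).comp (ι 𝒲)) :=
    oddGenerators_le fun n hn x hx => h1 n hn x hx y hy
  exact this hx

theorem ι_odd_mul_self {x : W} (hx : x ∈ oddGenerators 𝒲) : ι 𝒲 x * ι 𝒲 x = 0 := by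
  have h := ι_odd_mul_ι_odd hx hx
  have h2 : (2 : ℚ) • (ι 𝒲 x * ι 𝒲 x) = 0 := by
    rw [two_smul]; nth_rw 1 [h]; exact neg_add_cancel _
  exact (smul_eq_zero.1 h2).resolve_left two_ne_zero

/-- The hypothesis of the universal property only depends on the parity of degrees. -/
theorem lift_condition [DirectSum.Decomposition 𝒲] {B : Type*} [Ring B] [Algebra ℚ B]
    {f : W →ₗ[ℚ] B} (he : ∀ x ∈ evenGenerators 𝒲, ∀ y, f x * f y = f y * f x)
    (ho : ∀ x ∈ oddGenerators 𝒲, ∀ y ∈ oddGenerators 𝒲, f x * f y = - (f y * f x)) :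
    ∀ i j, ∀ x ∈ 𝒲 i, ∀ y ∈ 𝒲 j, f x * f y = (-1 : ℚ) ^ (i * j) • (f y * f x) := by
  intro i j x hx y hy
  rcases Nat.even_or_odd i with hi | hi
  · rw [(hi.mul_right _).neg_one_pow, one_smul, he x (mem_evenGenerators hi hx)]
  · rcases Nat.even_or_odd j with hj | hj
    · rw [(hj.mul_left _).neg_one_pow, one_smul, he y (mem_evenGenerators hj hy)]
    · rw [(hi.mul hj).neg_one_pow, neg_smul, one_smul,
        ho x (mem_oddGenerators hi hx) y (mem_oddGenerators hj hy)]

/-- Twisted derivations of `ΛW` of the form `w a ↦ φ(w) a + t(w) δ(a)` exist: such a map `δ` is the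
off-diagonal entry of a representation of `ΛW` by upper triangular matrices. -/
theorem exists_twisted_derivation (t : W →ₗ[ℚ] W) (φ : W →ₗ[ℚ] ℚ) (ht : ∀ n, ∀ w ∈ 𝒲 n, t w ∈ 𝒲 n)
    (h : ∀ i j, ∀ x ∈ 𝒲 i, ∀ y ∈ 𝒲 j,
      φ y • t x + φ x • y = (-1 : ℚ) ^ (i * j) • (φ x • t y + φ y • x)) :
    ∃ δ : FreeGCA 𝒲 →ₗ[ℚ] FreeGCA 𝒲, δ 1 = 0 ∧
      ∀ w a, δ (ι 𝒲 w * a) = φ w • a + ι 𝒲 (t w) * δ a := by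
  let f : W →ₗ[ℚ] Matrix (Fin 2) (Fin 2) (FreeGCA 𝒲) :=
    { toFun := fun w => !![ι 𝒲 (t w), algebraMap ℚ _ (φ w); 0, ι 𝒲 w]
      map_add' := fun v w => by
        ext i j; fin_cases i <;> fin_cases j <;> simp
      map_smul' := fun c w => by
        ext i j; fin_cases i <;> fin_cases j <;> simp [Algebra.smul_def] }
  have f_apply : ∀ w, f w = !![ι 𝒲 (t w), algebraMap ℚ _ (φ w); 0, ι 𝒲 w] := fun w => rfl
  have hf : ∀ i j, ∀ x ∈ 𝒲 i, ∀ y ∈ 𝒲 j, f x * f y = (-1 : ℚ) ^ (i * j) • (f y * f x) := by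
    intro i j x hx y hy
    have h' := congrArg (ι 𝒲) (h i j x hx y hy)
    simp only [map_add, map_smul] at h'
    rw [f_apply, f_apply, Matrix.mul_fin_two, Matrix.mul_fin_two]
    ext k l
    fin_cases k <;> fin_cases l
    · simpa using ι_mul_ι (ht i x hx) (ht j y hy)
    · simpa [← Algebra.commutes, ← Algebra.smul_def] using h'
    · simp
    · simpa using ι_mul_ι hx hy
  let F := lift f hf
  have hF : ∀ w a, F (ι 𝒲 w * a) = f w * F a := fun w a => by rw [map_mul, lift_ι]
  have hdiag : ∀ a, F a 1 1 = a := by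
    intro a
    have : (Matrix.entryLinearMap ℚ (FreeGCA 𝒲) (1 : Fin 2) (1 : Fin 2)).comp F.toLinearMap =
        LinearMap.id := by
      refine linearMap_ext (by change F 1 1 1 = 1; simp) fun w a ha => ?_
      have ha : F a 1 1 = a := ha
      change F (ι 𝒲 w * a) 1 1 = ι 𝒲 w * a
      rw [hF, Matrix.mul_apply, Fin.sum_univ_two, ha, f_apply]
      simp
    exact LinearMap.congr_fun this a
  refine ⟨(Matrix.entryLinearMap ℚ (FreeGCA 𝒲) (0 : Fin 2) (1 : Fin 2)).comp F.toLinearMap,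
    by change F 1 0 1 = 0; simp, fun w a => ?_⟩
  change F (ι 𝒲 w * a) 0 1 = φ w • a + ι 𝒲 (t w) * F a 0 1
  rw [hF, Matrix.mul_apply, Fin.sum_univ_two, hdiag, f_apply, Algebra.smul_def, add_comm]
  simp

/-- The derivation of `ΛW` of even degree that extends a linear form on the generators. -/
theorem exists_even_derivation (φ : W →ₗ[ℚ] ℚ) (hφ : ∀ w ∈ oddGenerators 𝒲, φ w = 0) :
    ∃ δ : FreeGCA 𝒲 →ₗ[ℚ] FreeGCA 𝒲, δ 1 = 0 ∧
      ∀ w a, δ (ι 𝒲 w * a) = φ w • a + ι 𝒲 w * δ a := by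
  refine exists_twisted_derivation LinearMap.id φ (fun n w hw => hw) fun i j x hx y hy => ?_
  rcases Nat.even_or_odd (i * j) with h | h
  · rw [h.neg_one_pow, one_smul, LinearMap.id_apply, LinearMap.id_apply, add_comm]
  · rw [Nat.odd_mul] at h
    simp [hφ x (mem_oddGenerators h.1 hx), hφ y (mem_oddGenerators h.2 hy)]

/-- The derivation of `ΛW` of odd degree that extends a linear form on the generators. -/
theorem exists_odd_derivation [DirectSum.Decomposition 𝒲] (φ : W →ₗ[ℚ] ℚ)
    (hφ : ∀ w ∈ evenGenerators 𝒲, φ w = 0) :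
    ∃ δ : FreeGCA 𝒲 →ₗ[ℚ] FreeGCA 𝒲, δ 1 = 0 ∧
      (∀ w ∈ evenGenerators 𝒲, ∀ a, δ (ι 𝒲 w * a) = ι 𝒲 w * δ a) ∧
      ∀ w ∈ oddGenerators 𝒲, ∀ a, δ (ι 𝒲 w * a) = φ w • a - ι 𝒲 w * δ a := by
  have ht : ∀ n, ∀ w ∈ 𝒲 n, degreeScaling 𝒲 (fun n => (-1) ^ n) w = (-1 : ℚ) ^ n • w :=
    fun n w hw => degreeScaling_of_mem _ hw
  obtain ⟨δ, h1, h⟩ := exists_twisted_derivation (𝒲 := 𝒲) (degreeScaling 𝒲 fun n => (-1) ^ n) φ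
    (fun n w hw => by rw [ht n w hw]; exact (𝒲 n).smul_mem _ hw) (fun i j x hx y hy => by
      rw [ht i x hx, ht j y hy]
      rcases Nat.even_or_odd i with hi | hi
      · simp [hφ x (mem_evenGenerators hi hx), hi.neg_one_pow, (hi.mul_right j).neg_one_pow]
      · rcases Nat.even_or_odd j with hj | hj
        · simp [hφ y (mem_evenGenerators hj hy), hj.neg_one_pow, (hj.mul_left i).neg_one_pow]
        · simp only [hi.neg_one_pow, hj.neg_one_pow, (hi.mul hj).neg_one_pow]
          module)
  refine ⟨δ, h1, fun w hw a => ?_, fun w hw a => ?_⟩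
  · have : evenGenerators 𝒲 ≤ LinearMap.eqLocus (degreeScaling 𝒲 fun n => (-1) ^ n)
        LinearMap.id := evenGenerators_le fun n hn w hw => by
      rw [LinearMap.mem_eqLocus, ht n w hw, hn.neg_one_pow, one_smul, LinearMap.id_apply]
    have := this hw
    rw [LinearMap.mem_eqLocus] at this
    rw [h, this, hφ w hw, zero_smul, zero_add, LinearMap.id_apply]
  · have : oddGenerators 𝒲 ≤ LinearMap.eqLocus (degreeScaling 𝒲 fun n => (-1) ^ n)
        (-LinearMap.id) := oddGenerators_le fun n hn w hw => by
      rw [LinearMap.mem_eqLocus, ht n w hw, hn.neg_one_pow, neg_smul, one_smul,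
        LinearMap.neg_apply, LinearMap.id_apply]
    have := this hw
    rw [LinearMap.mem_eqLocus] at this
    rw [h, this, LinearMap.neg_apply, LinearMap.id_apply, map_neg, neg_mul, sub_eq_add_neg]

end FreeGCA

namespace FreeGCA

/-! ### Ideals spanned by generators -/

section Ideals

variable {W : Type*} [AddCommGroup W] [Module ℚ W] {𝒲 : ℕ → Submodule ℚ W}

variable (𝒲) in
/-- The right ideal of `ΛW` generated by a space `R` of generators, as a subspace. It is a
two-sided ideal if `R` is the sum of its even and odd parts. -/
def rightIdeal (R : Submodule ℚ W) : Submodule ℚ (FreeGCA 𝒲) := R.map (ι 𝒲) * ⊤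

theorem ι_mul_mem_rightIdeal {R : Submodule ℚ W} {r : W} (hr : r ∈ R) (a : FreeGCA 𝒲) :
    ι 𝒲 r * a ∈ rightIdeal 𝒲 R :=
  Submodule.mul_mem_mul (Submodule.mem_map_of_mem hr) Submodule.mem_top

theorem ι_mem_rightIdeal {R : Submodule ℚ W} {r : W} (hr : r ∈ R) : ι 𝒲 r ∈ rightIdeal 𝒲 R := by
  simpa using ι_mul_mem_rightIdeal hr 1

theorem rightIdeal_le {R : Submodule ℚ W} {S : Submodule ℚ (FreeGCA 𝒲)}
    (h : ∀ r ∈ R, ∀ a, ι 𝒲 r * a ∈ S) : rightIdeal 𝒲 R ≤ S := by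
  refine Submodule.mul_le.2 ?_
  rintro _ ⟨r, hr, rfl⟩ a _
  exact h r hr a

theorem rightIdeal_mono {R R' : Submodule ℚ W} (h : R ≤ R') : rightIdeal 𝒲 R ≤ rightIdeal 𝒲 R' :=
  rightIdeal_le fun _ hr a => ι_mul_mem_rightIdeal (h hr) a

theorem rightIdeal_sup (R R' : Submodule ℚ W) :
    rightIdeal 𝒲 (R ⊔ R') = rightIdeal 𝒲 R ⊔ rightIdeal 𝒲 R' := by
  rw [rightIdeal, Submodule.map_sup, Submodule.sup_mul]
  rfl

theorem rightIdeal_span_range {k : Type*} [Fintype k] (x : k → W) :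
    rightIdeal 𝒲 (Submodule.span ℚ (Set.range x)) =
      ⨆ i ∈ (Finset.univ : Finset k), LinearMap.range (LinearMap.mulLeft ℚ (ι 𝒲 (x i))) := by
  refine le_antisymm (rightIdeal_le fun r hr a => ?_) (iSup₂_le fun i _ => ?_)
  · induction hr using Submodule.span_induction with
    | mem r hr =>
      obtain ⟨i, rfl⟩ := hr
      exact Submodule.mem_iSup_of_mem i (Submodule.mem_iSup_of_mem (Finset.mem_univ i) ⟨a, rfl⟩)
    | zero => simp
    | add r s _ _ hr hs => rw [map_add, add_mul]; exact Submodule.add_mem _ hr hs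
    | smul c r _ hr => rw [map_smul, smul_mul_assoc]; exact Submodule.smul_mem _ c hr
  · rintro _ ⟨a, rfl⟩
    exact ι_mul_mem_rightIdeal (Submodule.subset_span (Set.mem_range_self i)) a

theorem mul_mem_rightIdeal {R : Submodule ℚ W} {a : FreeGCA 𝒲} (ha : a ∈ rightIdeal 𝒲 R)
    (b : FreeGCA 𝒲) : a * b ∈ rightIdeal 𝒲 R := by
  have : rightIdeal 𝒲 R ≤ (rightIdeal 𝒲 R).comap (LinearMap.mulRight ℚ b) :=
    rightIdeal_le fun r hr a => by
      rw [Submodule.mem_comap, LinearMap.mulRight_apply, mul_assoc]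
      exact ι_mul_mem_rightIdeal hr _
  exact this ha

section

variable [DirectSum.Decomposition 𝒲]

theorem ι_mul_mem_rightIdeal_right {R : Submodule ℚ W}
    (hR : R ≤ R ⊓ evenGenerators 𝒲 ⊔ R ⊓ oddGenerators 𝒲) (w : W) {a : FreeGCA 𝒲}
    (ha : a ∈ rightIdeal 𝒲 R) : ι 𝒲 w * a ∈ rightIdeal 𝒲 R := by
  have : rightIdeal 𝒲 R ≤ (rightIdeal 𝒲 R).comap (LinearMap.mulLeft ℚ (ι 𝒲 w)) := by
    refine rightIdeal_le fun r hr a => ?_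
    rw [Submodule.mem_comap, LinearMap.mulLeft_apply]
    obtain ⟨e, he, o, ho, rfl⟩ := Submodule.mem_sup.1 (hR hr)
    rw [map_add, add_mul, mul_add]
    refine Submodule.add_mem _ ?_ ?_
    · rw [← mul_assoc, ← ι_even_mul he.2, mul_assoc]
      exact ι_mul_mem_rightIdeal he.1 _
    · have h1 := evenProjection_mem (𝒲 := 𝒲) w
      rw [← add_sub_cancel (evenProjection 𝒲 w) w, map_add, add_mul, ← mul_assoc, ← mul_assoc,
        ι_even_mul h1.1, ι_odd_mul_ι_odd h1.2 ho.2, neg_mul, mul_assoc, mul_assoc]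
      exact Submodule.add_mem _ (ι_mul_mem_rightIdeal ho.1 _)
        (Submodule.neg_mem _ (ι_mul_mem_rightIdeal ho.1 _))
  exact this ha

theorem mul_mem_rightIdeal_right {R : Submodule ℚ W}
    (hR : R ≤ R ⊓ evenGenerators 𝒲 ⊔ R ⊓ oddGenerators 𝒲) (b : FreeGCA 𝒲) {a : FreeGCA 𝒲}
    (ha : a ∈ rightIdeal 𝒲 R) : b * a ∈ rightIdeal 𝒲 R := by
  let S : Submodule ℚ (FreeGCA 𝒲) := ((rightIdeal 𝒲 R).comap (LinearMap.mulRight ℚ a))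
  have hS : S = ⊤ := eq_top_of_ι_mul_mem (by simpa [S] using ha) fun w b hb => by
    simp only [S, Submodule.mem_comap, LinearMap.mulRight_apply] at hb ⊢
    rw [mul_assoc]
    exact ι_mul_mem_rightIdeal_right hR w hb
  exact (hS ▸ Submodule.mem_top : b ∈ S)

end

/-- The homomorphism to `ΛW` from the exterior algebra of a space of odd generators. -/
def ofExterior {R : Submodule ℚ W} (hR : R ≤ oddGenerators 𝒲) :
    ExteriorAlgebra ℚ R →ₐ[ℚ] FreeGCA 𝒲 :=
  ExteriorAlgebra.lift ℚ ⟨(ι 𝒲).comp R.subtype, fun r => ι_odd_mul_self (hR r.2)⟩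

@[simp]
theorem ofExterior_ι {R : Submodule ℚ W} (hR : R ≤ oddGenerators 𝒲) (r : R) :
    ofExterior hR (ExteriorAlgebra.ι ℚ r) = ι 𝒲 r := by
  simp [ofExterior]

/-- More than `dim R` odd generators taken from `R` multiply to zero. -/
theorem map_ι_pow_eq_bot {R : Submodule ℚ W} [FiniteDimensional ℚ R] (hR : R ≤ oddGenerators 𝒲)
    {m : ℕ} (hm : finrank ℚ R < m) : R.map (ι 𝒲) ^ m = ⊥ := by
  have h1 : R.map (ι 𝒲) = (LinearMap.range (ExteriorAlgebra.ι ℚ (M := R))).map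
      (ofExterior hR).toLinearMap := by
    rw [← LinearMap.range_comp]
    ext a
    simp [LinearMap.mem_range]
  have h2 : LinearMap.range (ExteriorAlgebra.ι ℚ (M := R)) ^ m = ⊥ := by
    have h3 : finrank ℚ (⋀[ℚ]^m R) = 0 := by
      rw [exteriorPower.finrank_eq, Nat.choose_eq_zero_of_lt hm]
    exact Submodule.finrank_eq_zero.1 h3
  rw [h1, ← Submodule.map_pow, h2, Submodule.map_bot]

end Ideals

/-! ### Differentials of two-stage models -/

section Differential

variable {W : Type*} [AddCommGroup W] [Module ℚ W] {𝒲 : ℕ → Submodule ℚ W}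
variable {d : FreeGCA 𝒲 →ₗ[ℚ] FreeGCA 𝒲}

theorem ι_mem_degreePart {n : ℕ} {w : W} (hw : w ∈ 𝒲 n) : ι 𝒲 w ∈ degreePart 𝒲 n :=
  Submodule.subset_span ⟨[⟨n, w, hw⟩], by simp, by simp⟩

theorem _root_.IsCDGADifferential.map_one (hd : IsCDGADifferential 𝒲 d) : d 1 = 0 := by
  have h := hd.leibniz 0 1 (Submodule.subset_span ⟨[], by simp, by simp⟩) 1
  simpa using h

theorem _root_.IsCDGADifferential.even_mul (hd : IsCDGADifferential 𝒲 d) {w : W}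
    (hw : w ∈ evenGenerators 𝒲) (a : FreeGCA 𝒲) :
    d (ι 𝒲 w * a) = d (ι 𝒲 w) * a + ι 𝒲 w * d a := by
  have : evenGenerators 𝒲 ≤ LinearMap.eqLocus
      (d.comp ((LinearMap.mulRight ℚ a).comp (ι 𝒲)))
      ((LinearMap.mulRight ℚ a).comp (d.comp (ι 𝒲)) + (LinearMap.mulRight ℚ (d a)).comp (ι 𝒲)) :=
    evenGenerators_le fun n hn w hw => by
      have := hd.leibniz n _ (ι_mem_degreePart hw) a
      rwa [hn.neg_one_pow, one_smul] at this
  exact this hw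

theorem _root_.IsCDGADifferential.odd_mul (hd : IsCDGADifferential 𝒲 d) {w : W}
    (hw : w ∈ oddGenerators 𝒲) (a : FreeGCA 𝒲) :
    d (ι 𝒲 w * a) = d (ι 𝒲 w) * a - ι 𝒲 w * d a := by
  have : oddGenerators 𝒲 ≤ LinearMap.eqLocus
      (d.comp ((LinearMap.mulRight ℚ a).comp (ι 𝒲)))
      ((LinearMap.mulRight ℚ a).comp (d.comp (ι 𝒲)) - (LinearMap.mulRight ℚ (d a)).comp (ι 𝒲)) :=
    oddGenerators_le fun n hn w hw => by
      have := hd.leibniz n _ (ι_mem_degreePart hw) a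
      rwa [hn.neg_one_pow, neg_smul, one_smul, ← sub_eq_add_neg] at this
  exact this hw

theorem mul_rightIdeal_le (U : Submodule ℚ W) :
    U.map (ι 𝒲) * rightIdeal 𝒲 U ≤ rightIdeal 𝒲 U :=
  mul_le_mul' le_rfl le_top

variable [DirectSum.Decomposition 𝒲]

/-- On generators, the differential of a two-stage minimal model takes its values in
`Λ^{≥ 2}U · ΛW`. -/
theorem d_ι_mem {U V : Submodule ℚ W} (hmin : IsMinimalModel 𝒲 d) (htwo : IsTwoStage 𝒲 d U V)
    (w : W) : d (ι 𝒲 w) ∈ U.map (ι 𝒲) * rightIdeal 𝒲 U := by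
  obtain ⟨u, hu, v, hv, rfl⟩ :=
    Submodule.mem_sup.1 (htwo.isCompl.sup_eq_top ▸ Submodule.mem_top : w ∈ U ⊔ V)
  rw [map_add, map_add, htwo.d_left u hu, zero_add]
  let p : W →ₗ[ℚ] W := U.subtype.comp (Submodule.projectionOnto U V htwo.isCompl)
  have hpU : ∀ u ∈ U, p u = u := fun u hu =>
    congrArg Subtype.val (Submodule.projectionOnto_apply_left htwo.isCompl ⟨u, hu⟩)
  have hpV : ∀ v ∈ V, p v = 0 := fun v hv =>
    congrArg Subtype.val ((Submodule.projectionOnto_apply_eq_zero_iff htwo.isCompl).2 hv)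
  have hpe : ∀ w ∈ evenGenerators 𝒲, p w ∈ evenGenerators 𝒲 := fun w hw => by
    obtain ⟨u, hu, v, hv, rfl⟩ := Submodule.mem_sup.1
      (even_le_sup htwo.homogeneous_left htwo.homogeneous_right htwo.isCompl hw)
    rw [map_add, hpU u hu.1, hpV v hv, add_zero]
    exact hu.2
  have hpo : ∀ w ∈ oddGenerators 𝒲, p w ∈ oddGenerators 𝒲 := fun w hw => by
    obtain ⟨u, hu, v, hv, rfl⟩ := Submodule.mem_sup.1
      (odd_le_sup htwo.homogeneous_left htwo.homogeneous_right htwo.isCompl hw)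
    rw [map_add, hpU u hu.1, hpV v hv, add_zero]
    exact hu.2
  -- the retraction of `ΛW` onto `ΛU` fixes `d v`, and sends decomposables into `Λ^{≥ 2}U`
  let ρ : FreeGCA 𝒲 →ₐ[ℚ] FreeGCA 𝒲 := lift ((ι 𝒲).comp p) (lift_condition
    (fun x hx y => ι_even_mul (hpe x hx) _) (fun x hx y hy => ι_odd_mul_ι_odd (hpo x hx) (hpo y hy)))
  have hρ : ∀ a ∈ sub 𝒲 U, ρ a = a := fun a ha => by
    have : sub 𝒲 U ≤ AlgHom.equalizer ρ (AlgHom.id ℚ _) := by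
      refine Algebra.adjoin_le ?_
      rintro _ ⟨u, hu, rfl⟩
      change ρ (ι 𝒲 u) = ι 𝒲 u
      simp only [ρ, lift_ι, LinearMap.comp_apply, hpU u hu]
    exact this ha
  have hdec : decomposables 𝒲 ≤ (U.map (ι 𝒲) * rightIdeal 𝒲 U).comap ρ.toLinearMap := by
    refine iSup₂_le fun k hk => ?_
    rw [← Submodule.map_le_iff_le_comap, Submodule.map_pow, ← LinearMap.range_comp]
    have h1 : LinearMap.range (ρ.toLinearMap.comp (ι 𝒲)) ≤ U.map (ι 𝒲) := by
      rintro _ ⟨w, rfl⟩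
      refine ⟨p w, Subtype.prop _, ?_⟩
      simp [ρ]
    obtain ⟨k, rfl⟩ := Nat.exists_eq_add_of_le' hk
    refine (pow_le_pow_left' h1 _).trans ?_
    rw [pow_succ', pow_succ']
    exact mul_le_mul' le_rfl (mul_le_mul' le_rfl le_top)
  have h := hdec (hmin.minimal v)
  rwa [Submodule.mem_comap, AlgHom.toLinearMap_apply, hρ _ (htwo.d_right v hv)] at h

/-- Dividing a two-stage model by the even generators of its first stage, which are central
nonzerodivisors, at most doubles the dimension of the cohomology for each of them. -/
theorem cohomologyBoundMod_even {U V : Submodule ℚ W} [FiniteDimensional ℚ W]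
    (hmin : IsMinimalModel 𝒲 d) (htwo : IsTwoStage 𝒲 d U V) {n : ℕ}
    (h : CohomologyBoundMod d ⊥ n) :
    CohomologyBoundMod d (rightIdeal 𝒲 (U ⊓ evenGenerators 𝒲))
      (2 ^ finrank ℚ (U ⊓ evenGenerators 𝒲 : Submodule ℚ W) * n) := by
  have hd := hmin.toIsCDGADifferential
  obtain ⟨x, φ, hx, hspan, hφx, hφ⟩ :=
    exists_dual_family (isCompl_even_part htwo.homogeneous_left htwo.isCompl)
  have hφ' : ∀ i, ∀ w ∈ oddGenerators 𝒲, φ i w = 0 := fun i w hw =>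
    hφ i w (odd_le_sup htwo.homogeneous_left htwo.homogeneous_right htwo.isCompl hw)
  choose δ hδ1 hδ using fun i => exists_even_derivation (φ i) (hφ' i)
  have hnil : ∀ i c, ∃ m : ℕ, (δ i ^ m) c = 0 := by
    intro i c
    -- `δ i` lowers the word length in the generators `x i`, so it is locally nilpotent
    have step : ∀ w, ∀ m : ℕ, ∀ c, (δ i ^ m) c = 0 → (δ i ^ (m + 1)) (ι 𝒲 w * c) = 0 := by
      intro w m
      induction m with
      | zero =>
        intro c hc
        have : c = 0 := by simpa using hc
        simp [this]
      | succ m ih =>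
        intro c hc
        rw [pow_succ, Module.End.mul_apply, hδ, map_add, map_smul, hc, smul_zero, zero_add]
        exact ih _ (by rwa [pow_succ, Module.End.mul_apply] at hc)
    have htop : Module.End.maxGenEigenspace (δ i) 0 = ⊤ := by
      refine eq_top_of_ι_mul_mem ?_ fun w a ha => ?_
      · rw [Module.End.mem_maxGenEigenspace]
        exact ⟨1, by simp [hδ1]⟩
      · rw [Module.End.mem_maxGenEigenspace] at ha ⊢
        obtain ⟨m, hm⟩ := ha
        exact ⟨m + 1, by simpa using step w m a (by simpa using hm)⟩
    have := htop ▸ Submodule.mem_top (x := c)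
    rw [Module.End.mem_maxGenEigenspace] at this
    simpa using this
  have := h.iSup_range (X := fun i => LinearMap.mulLeft ℚ (ι 𝒲 (x i))) (δ := δ) hd.sq_zero
    (fun i c => by
      simp only [LinearMap.mulLeft_apply]
      rw [hd.even_mul (hx i).2, htwo.d_left _ (hx i).1, zero_mul, zero_add])
    (fun i j c => by
      simp only [LinearMap.mulLeft_apply]
      rw [← mul_assoc, ι_even_mul (hx i).2, mul_assoc])
    (fun i j c => by
      simp only [LinearMap.mulLeft_apply]
      rw [hδ, hφx, add_comm, ite_smul, one_smul, zero_smul])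
    hnil Finset.univ
  rw [Finset.card_univ, Fintype.card_fin] at this
  have hspan' := rightIdeal_span_range (𝒲 := 𝒲) x
  rw [hspan] at hspan'
  rwa [hspan']

end Differential

end FreeGCA

namespace FreeGCA

/-! ### Ellipticity forces the second stage to be odd -/

section SecondStageOdd

variable {W : Type*} [AddCommGroup W] [Module ℚ W] {𝒲 : ℕ → Submodule ℚ W}
variable [DirectSum.Decomposition 𝒲] {d : FreeGCA 𝒲 →ₗ[ℚ] FreeGCA 𝒲}

theorem le_even_sup_odd {U : Submodule ℚ W} (hU : U.IsHomogeneous 𝒲) :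
    U ≤ U ⊓ evenGenerators 𝒲 ⊔ U ⊓ oddGenerators 𝒲 :=
  (even_sup_odd hU).ge

theorem d_mem_rightIdeal {U V : Submodule ℚ W} (hmin : IsMinimalModel 𝒲 d)
    (htwo : IsTwoStage 𝒲 d U V) (a : FreeGCA 𝒲) : d a ∈ rightIdeal 𝒲 U := by
  have hd := hmin.toIsCDGADifferential
  have hU := le_even_sup_odd htwo.homogeneous_left
  have hι : ∀ w, d (ι 𝒲 w) ∈ rightIdeal 𝒲 U := fun w => mul_rightIdeal_le U (d_ι_mem hmin htwo w)
  have htop : (rightIdeal 𝒲 U).comap d = ⊤ := by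
    refine eq_top_of_ι_mul_mem (by simp [hd.map_one]) fun w a ha => ?_
    rw [Submodule.mem_comap] at ha ⊢
    have h1 := evenProjection_mem (𝒲 := 𝒲) w
    rw [← add_sub_cancel (evenProjection 𝒲 w) w, map_add, add_mul, map_add, hd.even_mul h1.1,
      hd.odd_mul h1.2]
    exact Submodule.add_mem _
      (Submodule.add_mem _ (mul_mem_rightIdeal (hι _) _) (ι_mul_mem_rightIdeal_right hU _ ha))
      (Submodule.sub_mem _ (mul_mem_rightIdeal (hι _) _) (ι_mul_mem_rightIdeal_right hU _ ha))
  exact (htop ▸ Submodule.mem_top : a ∈ (rightIdeal 𝒲 U).comap d)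

/-- The commutator `θ` of the differential with the contraction `δ` dual to an odd generator of the
first stage is `ΛU`-linear and takes its values in the ideal generated by `U`, by minimality.
Since more than `dim U^odd` odd elements of `U` multiply to zero, `θ` is nilpotent modulo the
ideal generated by `U^even`. -/
theorem commutator_pow_mem {U V : Submodule ℚ W} [FiniteDimensional ℚ W]
    (hmin : IsMinimalModel 𝒲 d) (htwo : IsTwoStage 𝒲 d U V) {ψ : W →ₗ[ℚ] ℚ}
    {δ : FreeGCA 𝒲 →ₗ[ℚ] FreeGCA 𝒲} (hδ1 : δ 1 = 0)
    (hδe : ∀ w ∈ evenGenerators 𝒲, ∀ a, δ (ι 𝒲 w * a) = ι 𝒲 w * δ a)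
    (hδo : ∀ w ∈ oddGenerators 𝒲, ∀ a, δ (ι 𝒲 w * a) = ψ w • a - ι 𝒲 w * δ a)
    (c : FreeGCA 𝒲) :
    ((δ ∘ₗ d + d ∘ₗ δ) ^ (finrank ℚ (U ⊓ oddGenerators 𝒲 : Submodule ℚ W) + 1)) c ∈
      rightIdeal 𝒲 (U ⊓ evenGenerators 𝒲) := by
  have hd := hmin.toIsCDGADifferential
  have hU := le_even_sup_odd htwo.homogeneous_left
  set θ : FreeGCA 𝒲 →ₗ[ℚ] FreeGCA 𝒲 := δ ∘ₗ d + d ∘ₗ δ with hθ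
  have θ_apply : ∀ c, θ c = δ (d c) + d (δ c) := fun c => rfl
  have hθe : ∀ w ∈ evenGenerators 𝒲, ∀ a,
      θ (ι 𝒲 w * a) = δ (d (ι 𝒲 w) * a) + d (ι 𝒲 w) * δ a + ι 𝒲 w * θ a := by
    intro w hw a
    rw [θ_apply, θ_apply, hd.even_mul hw, map_add, hδe w hw, hδe w hw, hd.even_mul hw, mul_add]
    abel
  have hθo : ∀ w ∈ oddGenerators 𝒲, ∀ a,
      θ (ι 𝒲 w * a) = δ (d (ι 𝒲 w) * a) - d (ι 𝒲 w) * δ a + ι 𝒲 w * θ a := by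
    intro w hw a
    rw [θ_apply, θ_apply, hd.odd_mul hw, map_sub, hδo w hw, hδo w hw, map_sub, map_smul,
      hd.odd_mul hw, mul_add]
    abel
  have hθU : ∀ u ∈ U, ∀ a, θ (ι 𝒲 u * a) = ι 𝒲 u * θ a := by
    intro u hu a
    obtain ⟨e, he, o, ho, rfl⟩ := Submodule.mem_sup.1 (hU hu)
    rw [map_add, add_mul, map_add, hθe e he.2, hθo o ho.2, htwo.d_left e he.1, htwo.d_left o ho.1]
    simp [add_mul]
  -- contraction shortens the products of elements of `U` by at most one
  have hδJ : ∀ a ∈ U.map (ι 𝒲) * rightIdeal 𝒲 U, δ a ∈ rightIdeal 𝒲 U := by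
    intro a ha
    have : U.map (ι 𝒲) * rightIdeal 𝒲 U ≤ (rightIdeal 𝒲 U).comap δ := by
      refine Submodule.mul_le.2 ?_
      rintro _ ⟨u, hu, rfl⟩ b hb
      obtain ⟨e, he, o, ho, rfl⟩ := Submodule.mem_sup.1 (hU hu)
      rw [Submodule.mem_comap, map_add, add_mul, map_add, hδe e he.2, hδo o ho.2]
      exact Submodule.add_mem _ (ι_mul_mem_rightIdeal he.1 _)
        (Submodule.sub_mem _ (Submodule.smul_mem _ _ hb) (ι_mul_mem_rightIdeal ho.1 _))
    exact this ha
  have hmulJ : ∀ w a, d (ι 𝒲 w) * a ∈ U.map (ι 𝒲) * rightIdeal 𝒲 U := by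
    intro w a
    have h1 : U.map (ι 𝒲) * rightIdeal 𝒲 U ≤
        (U.map (ι 𝒲) * rightIdeal 𝒲 U).comap (LinearMap.mulRight ℚ a) := by
      refine Submodule.mul_le.2 fun p hp b hb => ?_
      rw [Submodule.mem_comap, LinearMap.mulRight_apply, mul_assoc]
      exact Submodule.mul_mem_mul hp (mul_mem_rightIdeal hb a)
    exact h1 (d_ι_mem hmin htwo w)
  have hθJ : ∀ a, θ a ∈ rightIdeal 𝒲 U := by
    have htop : (rightIdeal 𝒲 U).comap θ = ⊤ := by
      refine eq_top_of_ι_mul_mem (by simp [θ_apply, hδ1, hd.map_one]) fun w a ha => ?_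
      rw [Submodule.mem_comap] at ha ⊢
      have h1 := evenProjection_mem (𝒲 := 𝒲) w
      have h2 : ∀ w, δ (d (ι 𝒲 w) * a) ∈ rightIdeal 𝒲 U := fun w => hδJ _ (hmulJ w a)
      have h3 : ∀ w, d (ι 𝒲 w) * δ a ∈ rightIdeal 𝒲 U := fun w =>
        mul_rightIdeal_le U (hmulJ w _)
      rw [← add_sub_cancel (evenProjection 𝒲 w) w, map_add, add_mul, map_add, hθe _ h1.1,
        hθo _ h1.2]
      exact Submodule.add_mem _
        (Submodule.add_mem _ (Submodule.add_mem _ (h2 _) (h3 _))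
          (ι_mul_mem_rightIdeal_right hU _ ha))
        (Submodule.add_mem _ (Submodule.sub_mem _ (h2 _) (h3 _))
          (ι_mul_mem_rightIdeal_right hU _ ha))
    exact fun a => (htop ▸ Submodule.mem_top : a ∈ (rightIdeal 𝒲 U).comap θ)
  set Uo : Submodule ℚ W := U ⊓ oddGenerators 𝒲 with hUo
  set I := rightIdeal 𝒲 (U ⊓ evenGenerators 𝒲) with hI
  have hIe : U ⊓ evenGenerators 𝒲 ≤ (U ⊓ evenGenerators 𝒲) ⊓ evenGenerators 𝒲 ⊔
      (U ⊓ evenGenerators 𝒲) ⊓ oddGenerators 𝒲 := fun x hx => Submodule.mem_sup_left ⟨hx, hx.2⟩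
  have hθI : I ≤ I.comap θ := rightIdeal_le fun r hr a => by
    rw [Submodule.mem_comap, hθU r hr.1]
    exact ι_mul_mem_rightIdeal hr _
  -- `θ` commutes with multiplication by products of elements of `U^odd`
  have hcomm : ∀ m : ℕ, ∀ p ∈ Uo.map (ι 𝒲) ^ m, ∀ a, θ (p * a) = p * θ a := by
    intro m
    induction m with
    | zero =>
      intro p hp a
      rw [pow_zero] at hp
      obtain ⟨r, rfl⟩ := Submodule.mem_one.1 hp
      rw [← Algebra.smul_def, ← Algebra.smul_def, map_smul]
    | succ m ih =>
      intro p hp a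
      rw [pow_succ'] at hp
      induction hp using Submodule.mul_induction_on' with
      | mem_mul_mem q hq p hp =>
        obtain ⟨u, hu, rfl⟩ := hq
        rw [mul_assoc, hθU u hu.1, ih p hp, mul_assoc]
      | add p _ q _ hp hq => rw [add_mul, map_add, hp, hq, add_mul]
  have hJ : rightIdeal 𝒲 U ≤ Uo.map (ι 𝒲) * ⊤ ⊔ I := by
    refine (rightIdeal_mono hU).trans ?_
    rw [rightIdeal_sup, sup_comm]
    exact le_rfl
  have hpow : ∀ m : ℕ, ∀ c, (θ ^ m) c ∈ Uo.map (ι 𝒲) ^ m * ⊤ ⊔ I := by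
    intro m
    induction m with
    | zero =>
      intro c
      rw [pow_zero, pow_zero, one_mul]
      exact Submodule.mem_sup_left Submodule.mem_top
    | succ m ih =>
      intro c
      rw [pow_succ' θ, Module.End.mul_apply]
      have h1 : Uo.map (ι 𝒲) ^ m * ⊤ ⊔ I ≤ (Uo.map (ι 𝒲) ^ (m + 1) * ⊤ ⊔ I).comap θ := by
        refine sup_le (Submodule.mul_le.2 fun p hp a _ => ?_) fun a ha =>
          Submodule.mem_sup_right (hθI ha)
        rw [Submodule.mem_comap, hcomm m p hp]
        obtain ⟨q, hq, i, hi, hqi⟩ := Submodule.mem_sup.1 (hJ (hθJ a))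
        rw [← hqi, mul_add, pow_succ, mul_assoc]
        exact Submodule.add_mem _ (Submodule.mem_sup_left (Submodule.mul_mem_mul hp hq))
          (Submodule.mem_sup_right (mul_mem_rightIdeal_right hIe p hi))
      exact h1 (ih c)
  have := hpow (finrank ℚ Uo + 1) c
  rwa [map_ι_pow_eq_bot inf_le_right (Nat.lt_succ_self _), Submodule.bot_mul, bot_sup_eq] at this

/-- Dividing a two-stage minimal model by its first stage leaves an algebra with zero differential,
of finite dimension if the cohomology of the model is finite-dimensional. -/
theorem exists_finiteDimensional_sup_rightIdeal {U V : Submodule ℚ W} [FiniteDimensional ℚ W]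
    (hmin : IsMinimalModel 𝒲 d) (htwo : IsTwoStage 𝒲 d U V) {n : ℕ}
    (h : CohomologyBoundMod d ⊥ n) :
    ∃ S : Submodule ℚ (FreeGCA 𝒲), FiniteDimensional ℚ S ∧ rightIdeal 𝒲 U ⊔ S = ⊤ := by
  have hd := hmin.toIsCDGADifferential
  obtain ⟨z, ψ, hz, hspan, hψz, hψ⟩ :=
    exists_dual_family (isCompl_odd_part htwo.homogeneous_left htwo.isCompl)
  have hψ' : ∀ i, ∀ w ∈ evenGenerators 𝒲, ψ i w = 0 := fun i w hw =>
    hψ i w (even_le_sup htwo.homogeneous_left htwo.homogeneous_right htwo.isCompl hw)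
  choose δ hδ1 hδe hδo using fun i => exists_odd_derivation (ψ i) (hψ' i)
  have hI : ∀ f : FreeGCA 𝒲 →ₗ[ℚ] FreeGCA 𝒲,
      (∀ w ∈ U ⊓ evenGenerators 𝒲, ∀ a, f (ι 𝒲 w * a) = ι 𝒲 w * f a) →
      rightIdeal 𝒲 (U ⊓ evenGenerators 𝒲) ≤ (rightIdeal 𝒲 (U ⊓ evenGenerators 𝒲)).comap f :=
    fun f hf => rightIdeal_le fun r hr a => by
      rw [Submodule.mem_comap, hf r hr]
      exact ι_mul_mem_rightIdeal hr _
  obtain ⟨n', S, hS, -, hSd⟩ := (cohomologyBoundMod_even hmin htwo h).sup_iSup_range_of_nilpotent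
    (z := fun i => LinearMap.mulLeft ℚ (ι 𝒲 (z i))) (δ := δ) hd.sq_zero
    (fun i c => by
      simp only [LinearMap.mulLeft_apply]
      rw [hd.odd_mul (hz i).2, htwo.d_left _ (hz i).1, zero_mul, zero_sub])
    (fun i j c => by
      simp only [LinearMap.mulLeft_apply]
      rw [← mul_assoc, ι_odd_mul_ι_odd (hz i).2 (hz j).2, neg_mul, mul_assoc])
    (fun i c => by
      simp only [LinearMap.mulLeft_apply]
      rw [← mul_assoc, ι_odd_mul_self (hz i).2, zero_mul])
    (fun i j c => by
      simp only [LinearMap.mulLeft_apply]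
      rw [hδo i _ (hz j).2, hψz, ite_smul, one_smul, zero_smul])
    (hI d fun w hw a => by rw [hd.even_mul hw.2, htwo.d_left w hw.1, zero_mul, zero_add])
    (fun i => hI _ fun w hw a => by
      simp only [LinearMap.mulLeft_apply]
      rw [← mul_assoc, ← ι_even_mul hw.2, mul_assoc])
    (fun i => hI _ fun w hw a => hδe i w hw.2 a)
    (fun i c => commutator_pow_mem hmin htwo (hδ1 i) (hδe i) (hδo i) c) Finset.univ
  have hspan' := rightIdeal_span_range (𝒲 := 𝒲) z
  rw [hspan] at hspan'
  rw [← hspan', ← rightIdeal_sup, even_sup_odd htwo.homogeneous_left] at hSd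
  refine ⟨S, hS, eq_top_iff.2 fun a _ => ?_⟩
  have hrange : LinearMap.range d ≤ rightIdeal 𝒲 U := by
    rintro _ ⟨b, rfl⟩
    exact d_mem_rightIdeal hmin htwo b
  have := hSd (Submodule.mem_comap.2 (d_mem_rightIdeal hmin htwo a))
  rwa [sup_eq_left.2 hrange] at this

/-- If the cohomology of a two-stage minimal model is finite-dimensional, then its second stage is
concentrated in odd degrees. -/
theorem right_le_oddGenerators {U V : Submodule ℚ W} [FiniteDimensional ℚ W]
    (hmin : IsMinimalModel 𝒲 d) (htwo : IsTwoStage 𝒲 d U V) {n : ℕ}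
    (h : CohomologyBoundMod d ⊥ n) : V ≤ oddGenerators 𝒲 := by
  obtain ⟨S, hS, hSU⟩ := exists_finiteDimensional_sup_rightIdeal hmin htwo h
  suffices hV : finrank ℚ (V ⊓ evenGenerators 𝒲 : Submodule ℚ W) = 0 by
    rw [Submodule.finrank_eq_zero] at hV
    refine (even_sup_odd htwo.homogeneous_right).ge.trans ?_
    rw [hV, bot_sup_eq]
    exact inf_le_right
  by_contra hne
  obtain ⟨x, φ, hx, -, hφx, hφ⟩ :=
    exists_dual_family (isCompl_even_part htwo.homogeneous_right htwo.isCompl.symm)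
  let k : Fin (finrank ℚ (V ⊓ evenGenerators 𝒲 : Submodule ℚ W)) := ⟨0, Nat.pos_of_ne_zero hne⟩
  have hφo : ∀ w ∈ oddGenerators 𝒲, φ k w = 0 := fun w hw =>
    hφ k w (odd_le_sup htwo.homogeneous_right htwo.homogeneous_left htwo.isCompl.symm hw)
  -- an even generator of `V` would give a homomorphism of `ΛW` onto `ℚ[X]` that kills `U`
  let F : FreeGCA 𝒲 →ₐ[ℚ] Polynomial ℚ :=
    lift ((LinearMap.toSpanSingleton ℚ (Polynomial ℚ) Polynomial.X).comp (φ k))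
      (lift_condition (fun x _ y => mul_comm _ _) fun x hx y _ => by simp [hφo x hx])
  have hF : ∀ w, F (ι 𝒲 w) = φ k w • Polynomial.X := fun w => by simp [F]
  have hFU : rightIdeal 𝒲 U ≤ LinearMap.ker F.toLinearMap := rightIdeal_le fun u hu a => by
    rw [LinearMap.mem_ker, AlgHom.toLinearMap_apply, map_mul, hF,
      hφ k u (Submodule.mem_sup_right hu), zero_smul, zero_mul]
  have hsurj : LinearMap.range F.toLinearMap = ⊤ := by
    refine eq_top_iff.2 fun p _ => ⟨Polynomial.aeval (ι 𝒲 (x k)) p, ?_⟩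
    rw [AlgHom.toLinearMap_apply, ← Polynomial.aeval_algHom_apply, hF, hφx, if_pos rfl, one_smul,
      Polynomial.aeval_X_left_apply]
  have htop : S.map F.toLinearMap = ⊤ := by
    have hbot : (rightIdeal 𝒲 U).map F.toLinearMap = ⊥ :=
      eq_bot_iff.2 (Submodule.map_le_iff_le_comap.2 hFU)
    rw [← hsurj, LinearMap.range_eq_map, ← hSU, Submodule.map_sup, hbot, bot_sup_eq]
  have : FiniteDimensional ℚ (⊤ : Submodule ℚ (Polynomial ℚ)) := htop ▸ inferInstance
  exact Polynomial.not_finite (R := ℚ) (Module.Finite.of_surjective _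
    (Submodule.topEquiv (R := ℚ) (M := Polynomial ℚ)).surjective)

end SecondStageOdd

end FreeGCA

/-! ### Transfer of cohomology bounds, and bases of exterior algebras -/

section Transfer

variable {K C C' : Type*} [Field K] [AddCommGroup C] [Module K C] [AddCommGroup C'] [Module K C']

/-- A map `C' → C` that induces an isomorphism of complexes from `C'` to `C / I` transfers bounds
on cohomology. -/
theorem CohomologyBoundMod.of_comparison {d : C →ₗ[K] C} {D : C' →ₗ[K] C'} {Ψ : C' →ₗ[K] C}
    {I : Submodule K C} {n : ℕ} (hdI : I ≤ I.comap d) (hΨ : ∀ f, d (Ψ f) - Ψ (D f) ∈ I)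
    (hinj : ∀ f, Ψ f ∈ I → f = 0) (hsurj : I ⊔ LinearMap.range Ψ = ⊤)
    (h : CohomologyBoundMod d I n) : CohomologyBoundMod D ⊥ n := by
  obtain ⟨S, hS, hSn, hSd⟩ := h
  obtain ⟨T, hT, hTS, hTR⟩ := exists_submodule_of_linear_relation
    (I.comap (LinearMap.fst K C C' - Ψ.comp (LinearMap.snd K C C'))) S
  have hlift : ∀ a, ∃ g, a - Ψ g ∈ I := fun a => by
    obtain ⟨i, hi, _, ⟨g, rfl⟩, rfl⟩ :=
      Submodule.mem_sup.1 (hsurj ▸ Submodule.mem_top : a ∈ I ⊔ LinearMap.range Ψ)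
    exact ⟨g, by simpa using hi⟩
  refine ⟨T, hT, hTS.trans hSn, fun f hf => ?_⟩
  have hf : D f = 0 := by simpa using hf
  have hdf : d (Ψ f) ∈ I := by simpa [hf] using hΨ f
  obtain ⟨_, h1, s, hs, hfs⟩ := Submodule.mem_sup.1 (hSd (Submodule.mem_comap.2 hdf))
  obtain ⟨i, hi, _, ⟨a, rfl⟩, rfl⟩ := Submodule.mem_sup.1 h1
  obtain ⟨g, hg⟩ := hlift a
  obtain ⟨g', hg'⟩ := hlift s
  obtain ⟨t, ht, hst⟩ := hTR s hs g' (by simpa using hg')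
  have hst : s - Ψ t ∈ I := by simpa using hst
  have h0 : f - D g - t = 0 := hinj _ (by
    have h2 : Ψ (f - D g - t) = i + d (a - Ψ g) + (d (Ψ g) - Ψ (D g)) + (s - Ψ t) := by
      rw [map_sub, map_sub, map_sub, ← hfs]; abel
    rw [h2]
    exact I.add_mem (I.add_mem (I.add_mem hi (hdI hg)) (hΨ g)) hst)
  rw [bot_sup_eq, sub_eq_zero.1 (by rw [← h0]; abel : f - (D g + t) = 0)]
  exact Submodule.add_mem _ (Submodule.mem_sup_left ⟨g, rfl⟩) (Submodule.mem_sup_right ht)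

/-- The dimension of the cohomology of a complex bounds it in the sense of `CohomologyBoundMod`. -/
theorem cohomologyBoundMod_finrank (d : C →ₗ[K] C)
    [FiniteDimensional K (LinearMap.ker d ⧸ (LinearMap.range d).submoduleOf (LinearMap.ker d))] :
    CohomologyBoundMod d ⊥
      (finrank K (LinearMap.ker d ⧸ (LinearMap.range d).submoduleOf (LinearMap.ker d))) := by
  let B := (LinearMap.range d).submoduleOf (LinearMap.ker d)
  obtain ⟨g, hg⟩ := B.mkQ.exists_rightInverse_of_surjective
    (LinearMap.range_eq_top.2 B.mkQ_surjective)
  let s : (LinearMap.ker d ⧸ B) →ₗ[K] C := (LinearMap.ker d).subtype.comp g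
  refine ⟨LinearMap.range s, inferInstance, LinearMap.finrank_range_le s, fun c hc => ?_⟩
  have hc : c ∈ LinearMap.ker d := by simpa using hc
  let c' : LinearMap.ker d := ⟨c, hc⟩
  have h1 : c' - g (B.mkQ c') ∈ B := by
    rw [← Submodule.Quotient.mk_eq_zero, ← Submodule.mkQ_apply, map_sub, sub_eq_zero]
    exact (LinearMap.congr_fun hg (B.mkQ c')).symm
  have h2 : c = (c - s (B.mkQ c')) + s (B.mkQ c') := by abel
  rw [bot_sup_eq, h2]
  exact Submodule.add_mem _ (Submodule.mem_sup_left h1) (Submodule.mem_sup_right ⟨_, rfl⟩)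

theorem finrank_exteriorAlgebra [FiniteDimensional K C] :
    finrank K (ExteriorAlgebra K C) = 2 ^ finrank K C := by
  rw [finrank_eq_card_basis (Module.finBasis K C).ExteriorAlgebra, Fintype.card_finset,
    Fintype.card_fin]

theorem finiteDimensional_exteriorAlgebra [FiniteDimensional K C] :
    FiniteDimensional K (ExteriorAlgebra K C) :=
  Module.Finite.of_basis (Module.finBasis K C).ExteriorAlgebra

/-- A homogeneous basis of an exterior algebra, ordered by degree: multiplication by elements
without constant term is strictly triangular. -/
theorem exists_triangular_basis [FiniteDimensional K C] :
    ∃ (n : ℕ) (e : Basis (Fin n) K (ExteriorAlgebra K C)), 0 < n ∧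
      ∀ y ∈ LinearMap.range (ExteriorAlgebra.ι K (M := C)) * ⊤, ∀ i j, i ≤ j →
        e.repr (y * e j) i = 0 := by
  let B := (Module.finBasis K C).ExteriorAlgebra
  have hB : ∀ s : Finset (Fin (finrank K C)), B s ∈ ⋀[K]^s.card C := fun s => by
    simp only [B]
    rw [ExteriorAlgebra.basis_apply]
    exact Subtype.prop (exteriorPower.ιMulti_family K s.card (Module.finBasis K C)
      (Set.powersetCard.prodEquiv.symm s).2)
  have hrepr : ∀ m, ∀ x ∈ ⋀[K]^m C, ∀ s : Finset (Fin (finrank K C)), m ≠ s.card →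
      B.repr x s = 0 := by
    intro m x hx s hms
    simp only [B, Basis.ExteriorAlgebra, Basis.repr_reindex, Finsupp.mapDomain_equiv_apply]
    exact DirectSum.IsInternal.collectedBasis_repr_of_mem_ne _ _ hms hx
  let N := Fintype.card (Finset (Fin (finrank K C)))
  let e₀ : Fin N ≃ Finset (Fin (finrank K C)) := (Fintype.equivFin _).symm
  let σ : Equiv.Perm (Fin N) := Tuple.sort fun i => (e₀ i).card
  have hσ : Monotone fun i => (e₀ (σ i)).card := Tuple.monotone_sort fun i => (e₀ i).card
  refine ⟨N, B.reindex (σ.trans e₀).symm, Fintype.card_pos, fun y hy i j hij => ?_⟩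
  have hcard : (e₀ (σ i)).card ≤ (e₀ (σ j)).card := hσ hij
  rw [Basis.reindex_apply, Basis.repr_reindex_apply]
  simp only [Equiv.symm_symm, Equiv.trans_apply]
  generalize e₀ (σ i) = s at hcard ⊢
  generalize e₀ (σ j) = t at hcard ⊢
  induction hy using Submodule.mul_induction_on' with
  | mem_mul_mem r hr a ha =>
    induction a using DirectSum.Decomposition.inductionOn (fun i : ℕ => ⋀[K]^i C) with
    | zero => simp
    | @homogeneous l a =>
      have hr1 : r ∈ ⋀[K]^1 C := by simpa using hr
      refine hrepr (1 + l + t.card) _ (SetLike.mul_mem_graded (SetLike.mul_mem_graded hr1 a.2)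
        (hB t)) s ?_
      omega
    | add a b iha ihb =>
      rw [mul_add, add_mul, map_add, Finsupp.add_apply, iha Submodule.mem_top,
        ihb Submodule.mem_top, add_zero]
  | add x _ y _ hx hy => rw [add_mul, map_add, Finsupp.add_apply, hx, hy, add_zero]

end Transfer

namespace FreeGCA

/-! ### The model modulo the even generators of its first stage -/

section Koszul

variable {W : Type*} [AddCommGroup W] [Module ℚ W] {𝒲 : ℕ → Submodule ℚ W}
theorem mul_ι_of_mem_degreePart {n m : ℕ} {a : FreeGCA 𝒲} (ha : a ∈ degreePart 𝒲 n) {w : W}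
    (hw : w ∈ 𝒲 m) : a * ι 𝒲 w = (-1 : ℚ) ^ (n * m) • (ι 𝒲 w * a) := by
  have h : ∀ l : List (Σ i : ℕ, 𝒲 i), (l.map fun w => ι 𝒲 (w.2 : W)).prod * ι 𝒲 w =
      (-1 : ℚ) ^ ((l.map fun w => w.1).sum * m) •
        (ι 𝒲 w * (l.map fun w => ι 𝒲 (w.2 : W)).prod) := by
    intro l
    induction l with
    | nil => simp
    | cons v l ih =>
      rw [List.map_cons, List.prod_cons, List.map_cons, List.sum_cons, mul_assoc, ih,
        mul_smul_comm, ← mul_assoc, ι_mul_ι v.2.2 hw, smul_mul_assoc, smul_smul, mul_assoc,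
        add_mul, pow_add, mul_comm]
  induction ha using Submodule.span_induction with
  | mem a ha => obtain ⟨l, rfl, rfl⟩ := ha; exact h l
  | zero => simp
  | add a b _ _ ha hb => rw [add_mul, ha, hb, mul_add, smul_add]
  | smul c a _ ha => rw [smul_mul_assoc, ha, mul_smul_comm, smul_comm]

theorem rightIdeal_even_le {U : Submodule ℚ W} : U ⊓ evenGenerators 𝒲 ≤
    (U ⊓ evenGenerators 𝒲) ⊓ evenGenerators 𝒲 ⊔ (U ⊓ evenGenerators 𝒲) ⊓ oddGenerators 𝒲 :=
  fun _ hx => Submodule.mem_sup_left ⟨hx, hx.2⟩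

variable [DirectSum.Decomposition 𝒲] {d : FreeGCA 𝒲 →ₗ[ℚ] FreeGCA 𝒲}

theorem mul_comm_of_mem_degreePart {n : ℕ} (hn : Even n) {a : FreeGCA 𝒲}
    (ha : a ∈ degreePart 𝒲 n) (b : FreeGCA 𝒲) : a * b = b * a := by
  have hι : ∀ w, a * ι 𝒲 w = ι 𝒲 w * a := fun w => by
    induction w using DirectSum.Decomposition.inductionOn 𝒲 with
    | zero => simp
    | homogeneous w => rw [mul_ι_of_mem_degreePart ha w.2, (hn.mul_right _).neg_one_pow, one_smul]
    | add v w hv hw => rw [map_add, mul_add, add_mul, hv, hw]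
  have h : LinearMap.mulLeft ℚ a = LinearMap.mulRight ℚ a := by
    refine linearMap_ext (by simp) fun w b hb => ?_
    have hb : a * b = b * a := hb
    change a * (ι 𝒲 w * b) = ι 𝒲 w * b * a
    rw [← mul_assoc, hι, mul_assoc, hb, mul_assoc]
  exact LinearMap.congr_fun h b

/-- The differential of an odd generator has even degree, so it is central. -/
theorem d_ι_odd_mul_comm (hd : IsCDGADifferential 𝒲 d) {w : W} (hw : w ∈ oddGenerators 𝒲)
    (a : FreeGCA 𝒲) : d (ι 𝒲 w) * a = a * d (ι 𝒲 w) := by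
  have : oddGenerators 𝒲 ≤ LinearMap.eqLocus
      ((LinearMap.mulRight ℚ a).comp (d.comp (ι 𝒲)))
      ((LinearMap.mulLeft ℚ a).comp (d.comp (ι 𝒲))) :=
    oddGenerators_le fun n hn w hw =>
      mul_comm_of_mem_degreePart hn.add_one (hd.degree n _ (ι_mem_degreePart hw)) a
  exact this hw

/-- The retraction of `ΛW` onto the exterior algebra of the odd part of the first stage. -/
def toExterior {U V : Submodule ℚ W} (hU : U.IsHomogeneous 𝒲) (hV : V.IsHomogeneous 𝒲)
    (hUV : IsCompl U V) :
    FreeGCA 𝒲 →ₐ[ℚ] ExteriorAlgebra ℚ (U ⊓ oddGenerators 𝒲 : Submodule ℚ W) :=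
  lift ((ExteriorAlgebra.ι ℚ).comp (Submodule.projectionOnto _ _ (isCompl_odd_part hU hUV)))
    (lift_condition
      (fun x hx y => by
        rw [LinearMap.comp_apply, (Submodule.projectionOnto_apply_eq_zero_iff _).2
          (even_le_sup hU hV hUV hx), map_zero, zero_mul, mul_zero])
      (fun x _ y _ => eq_neg_of_add_eq_zero_left (ExteriorAlgebra.ι_add_mul_swap _ _)))

theorem toExterior_ι {U V : Submodule ℚ W} (hU : U.IsHomogeneous 𝒲) (hV : V.IsHomogeneous 𝒲)
    (hUV : IsCompl U V) (w : W) : toExterior hU hV hUV (ι 𝒲 w) =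
      ExteriorAlgebra.ι ℚ (Submodule.projectionOnto _ _ (isCompl_odd_part hU hUV) w) := by
  simp [toExterior]

/-- On `ΛU`, the retraction onto the exterior algebra of `U^odd` is the quotient map by the ideal
generated by `U^even`. -/
theorem ofExterior_toExterior_sub_mem {U V : Submodule ℚ W} (hU : U.IsHomogeneous 𝒲)
    (hV : V.IsHomogeneous 𝒲) (hUV : IsCompl U V) {a : FreeGCA 𝒲} (ha : a ∈ sub 𝒲 U) :
    ofExterior (inf_le_right : U ⊓ oddGenerators 𝒲 ≤ _) (toExterior hU hV hUV a) - a ∈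
      rightIdeal 𝒲 (U ⊓ evenGenerators 𝒲) := by
  induction ha using Algebra.adjoin_induction with
  | mem x hx =>
    obtain ⟨u, hu, rfl⟩ := hx
    obtain ⟨e, he, o, ho, rfl⟩ := Submodule.mem_sup.1 (le_even_sup_odd hU hu)
    have h1 := Submodule.projectionOnto_apply_left (isCompl_odd_part hU hUV) ⟨o, ho⟩
    have h2 := (Submodule.projectionOnto_apply_eq_zero_iff (isCompl_odd_part hU hUV)).2
      (Submodule.mem_sup_left he)
    rw [toExterior_ι, map_add, h1, h2, zero_add, ofExterior_ι, map_add, sub_add_cancel_right]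
    exact Submodule.neg_mem _ (ι_mem_rightIdeal he)
  | algebraMap r => simp
  | add a b _ _ ha hb =>
    rw [map_add, map_add, add_sub_add_comm]
    exact Submodule.add_mem _ ha hb
  | mul a b _ _ ha hb =>
    rw [map_mul, map_mul]
    set a' := ofExterior (inf_le_right : U ⊓ oddGenerators 𝒲 ≤ _) (toExterior hU hV hUV a)
    set b' := ofExterior (inf_le_right : U ⊓ oddGenerators 𝒲 ≤ _) (toExterior hU hV hUV b)
    have : a' * b' - a * b = a' * (b' - b) + (a' - a) * b := by noncomm_ring
    rw [this]
    exact Submodule.add_mem _ (mul_mem_rightIdeal_right rightIdeal_even_le _ hb)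
      (mul_mem_rightIdeal ha _)

theorem toExterior_d_mem {U V : Submodule ℚ W} (hmin : IsMinimalModel 𝒲 d)
    (htwo : IsTwoStage 𝒲 d U V) (w : W) :
    toExterior htwo.homogeneous_left htwo.homogeneous_right htwo.isCompl (d (ι 𝒲 w)) ∈
      LinearMap.range (ExteriorAlgebra.ι ℚ
        (M := (U ⊓ oddGenerators 𝒲 : Submodule ℚ W))) * ⊤ := by
  have : rightIdeal 𝒲 U ≤ (LinearMap.range (ExteriorAlgebra.ι ℚ
      (M := (U ⊓ oddGenerators 𝒲 : Submodule ℚ W))) * ⊤).comap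
      (toExterior htwo.homogeneous_left htwo.homogeneous_right htwo.isCompl).toLinearMap :=
    rightIdeal_le fun u _ a => by
      rw [Submodule.mem_comap, AlgHom.toLinearMap_apply, map_mul, toExterior_ι]
      exact Submodule.mul_mem_mul ⟨_, rfl⟩ Submodule.mem_top
  exact this (d_mem_rightIdeal hmin htwo _)

theorem d_ofExterior {U V : Submodule ℚ W} (hmin : IsMinimalModel 𝒲 d)
    (htwo : IsTwoStage 𝒲 d U V)
    (m : ExteriorAlgebra ℚ (U ⊓ oddGenerators 𝒲 : Submodule ℚ W)) :
    d (ofExterior inf_le_right m) = 0 := by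
  have hd := hmin.toIsCDGADifferential
  induction m using CliffordAlgebra.left_induction with
  | algebraMap r =>
    rw [AlgHom.commutes, Algebra.algebraMap_eq_smul_one, map_smul, hd.map_one, smul_zero]
  | add a b ha hb => rw [map_add, map_add, ha, hb, add_zero]
  | ι_mul m u hm =>
    rw [map_mul]
    have hιu : ofExterior (inf_le_right : U ⊓ oddGenerators 𝒲 ≤ _) (CliffordAlgebra.ι 0 u) =
        ι 𝒲 u := ofExterior_ι _ u
    rw [hιu, hd.odd_mul u.2.2, htwo.d_left _ u.2.1, hm, zero_mul, mul_zero, sub_zero]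

/-- The differential of a product of elements of `ΛV` and `ΛU^odd`, modulo the ideal generated by
`U^even`: it is a sum of contractions on the first factor, with coefficients that act on the
second one by multiplication. -/
theorem d_mul_sub_sum_mem {U V : Submodule ℚ W} (hmin : IsMinimalModel 𝒲 d)
    (htwo : IsTwoStage 𝒲 d U V) (hV : V ≤ oddGenerators 𝒲) {n : ℕ}
    (e : Basis (Fin n) ℚ (ExteriorAlgebra ℚ (U ⊓ oddGenerators 𝒲 : Submodule ℚ W))) (j : Fin n)
    (φ : Fin n → Module.Dual ℚ V)
    (hφ : ∀ i v, φ i v = e.repr (toExterior htwo.homogeneous_left htwo.homogeneous_right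
      htwo.isCompl (d (ι 𝒲 v)) * e j) i) (b : ExteriorAlgebra ℚ V) :
    d (ofExterior hV b * ofExterior inf_le_right (e j)) -
      ∑ i, ofExterior hV (CliffordAlgebra.contractLeft (φ i) b) * ofExterior inf_le_right (e i) ∈
        rightIdeal 𝒲 (U ⊓ evenGenerators 𝒲) := by
  have hd := hmin.toIsCDGADifferential
  set I := rightIdeal 𝒲 (U ⊓ evenGenerators 𝒲)
  induction b using CliffordAlgebra.left_induction with
  | algebraMap r =>
    rw [AlgHom.commutes, ← Algebra.smul_def, map_smul, d_ofExterior hmin htwo]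
    simp [CliffordAlgebra.contractLeft_algebraMap]
  | add a b ha hb =>
    simp only [map_add, add_mul, Finset.sum_add_distrib]
    rw [add_sub_add_comm]
    exact I.add_mem ha hb
  | ι_mul b v hb =>
    have hιv : ofExterior hV (CliffordAlgebra.ι 0 v) = ι 𝒲 v := ofExterior_ι hV v
    set y := toExterior htwo.homogeneous_left htwo.homogeneous_right htwo.isCompl (d (ι 𝒲 v))
      with hy
    have hsum : ∑ i, φ i v • (e i) = y * e j := by
      simp only [hφ]
      exact e.sum_repr _
    have h1 : ∑ i, ofExterior hV (CliffordAlgebra.contractLeft (φ i) (CliffordAlgebra.ι 0 v * b)) *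
        ofExterior inf_le_right (e i) =
        ofExterior hV b * (ofExterior inf_le_right y * ofExterior inf_le_right (e j)) -
        ι 𝒲 v * ∑ i, ofExterior hV (CliffordAlgebra.contractLeft (φ i) b) *
          ofExterior inf_le_right (e i) := by
      rw [← map_mul, ← hsum, map_sum, Finset.mul_sum, Finset.mul_sum, ← Finset.sum_sub_distrib]
      refine Finset.sum_congr rfl fun i _ => ?_
      rw [CliffordAlgebra.contractLeft_ι_mul, map_sub, map_mul, hιv, map_smul, sub_mul, map_smul,
        smul_mul_assoc, mul_smul_comm, mul_assoc]
    have h2 : d (ofExterior hV (CliffordAlgebra.ι 0 v * b) * ofExterior inf_le_right (e j)) =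
        ofExterior hV b * (d (ι 𝒲 v) * ofExterior inf_le_right (e j)) -
          ι 𝒲 v * d (ofExterior hV b * ofExterior inf_le_right (e j)) := by
      rw [map_mul (ofExterior hV), hιv, mul_assoc, hd.odd_mul (hV v.2), ← mul_assoc,
        d_ι_odd_mul_comm hd (hV v.2), mul_assoc]
    have h3 : ofExterior inf_le_right y - d (ι 𝒲 v) ∈ I :=
      ofExterior_toExterior_sub_mem _ _ _ (htwo.d_right v v.2)
    rw [h1, h2]
    have h4 : ∀ p q r s : FreeGCA 𝒲, p - q - (r - s) = -(r - p) - (q - s) := fun p q r s => by abel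
    rw [h4, ← mul_sub, ← mul_sub, ← sub_mul]
    exact I.sub_mem (I.neg_mem (mul_mem_rightIdeal_right rightIdeal_even_le _
      (mul_mem_rightIdeal h3 _))) (mul_mem_rightIdeal_right rightIdeal_even_le _ hb)

/-- The products of elements of `ΛV` and `ΛU^odd` span `ΛW` modulo the ideal generated by
`U^even`. -/
theorem rightIdeal_sup_mul_eq_top {U V : Submodule ℚ W} (hU : U.IsHomogeneous 𝒲)
    (hUV : IsCompl U V) (hV : V ≤ oddGenerators 𝒲) :
    rightIdeal 𝒲 (U ⊓ evenGenerators 𝒲) ⊔ LinearMap.range (ofExterior hV).toLinearMap *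
      LinearMap.range (ofExterior (inf_le_right : U ⊓ oddGenerators 𝒲 ≤ _)).toLinearMap = ⊤ := by
  set jV := (ofExterior hV).toLinearMap with hjV
  set jU := (ofExterior (inf_le_right : U ⊓ oddGenerators 𝒲 ≤ _)).toLinearMap with hjU
  -- odd generators of `U` can be moved past `ΛV` up to sign
  have hswap : ∀ o ∈ U ⊓ oddGenerators 𝒲, ∀ b : ExteriorAlgebra ℚ V,
      ι 𝒲 o * jV b = jV (CliffordAlgebra.involute b) * ι 𝒲 o := by
    intro o ho b
    induction b using CliffordAlgebra.left_induction with
    | algebraMap r =>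
      simp only [hjV, AlgHom.toLinearMap_apply, AlgHom.commutes]
      exact (Algebra.commutes r _).symm
    | add a b ha hb => rw [map_add, map_add, map_add, mul_add, add_mul, ha, hb]
    | ι_mul b v hb =>
      have hιv : ofExterior hV (CliffordAlgebra.ι 0 v) = ι 𝒲 v := ofExterior_ι hV v
      simp only [hjV, AlgHom.toLinearMap_apply, map_mul, CliffordAlgebra.involute_ι, map_neg,
        hιv] at hb ⊢
      rw [← mul_assoc, ι_odd_mul_ι_odd ho.2 (hV v.2), neg_mul, mul_assoc, hb]
      simp only [neg_mul, mul_assoc]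
  refine eq_top_of_ι_mul_mem (Submodule.mem_sup_right ?_) fun w a ha => ?_
  · have := Submodule.mul_mem_mul (LinearMap.mem_range_self jV 1) (LinearMap.mem_range_self jU 1)
    simpa [hjV, hjU] using this
  · obtain ⟨i, hi, t, ht, rfl⟩ := Submodule.mem_sup.1 ha
    rw [mul_add]
    clear ha
    refine Submodule.add_mem _
      (Submodule.mem_sup_left (mul_mem_rightIdeal_right rightIdeal_even_le _ hi)) ?_
    obtain ⟨u, hu, v, hv, rfl⟩ := Submodule.mem_sup.1 (hUV.sup_eq_top ▸ Submodule.mem_top : w ∈ U ⊔ V)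
    obtain ⟨e, he, o, ho, rfl⟩ := Submodule.mem_sup.1 (le_even_sup_odd hU hu)
    rw [map_add, map_add, add_mul, add_mul]
    refine Submodule.add_mem _ (Submodule.add_mem _
      (Submodule.mem_sup_left (ι_mul_mem_rightIdeal he _)) (Submodule.mem_sup_right ?_))
      (Submodule.mem_sup_right ?_)
    · induction ht using Submodule.mul_induction_on' with
      | mem_mul_mem p hp q hq =>
        obtain ⟨b, rfl⟩ := hp
        obtain ⟨m, rfl⟩ := hq
        rw [← mul_assoc, hswap o ho, mul_assoc]
        refine Submodule.mul_mem_mul ⟨_, rfl⟩ ⟨ExteriorAlgebra.ι ℚ ⟨o, ho⟩ * m, ?_⟩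
        simp [hjU]
      | add p _ q _ hp hq =>
        rw [mul_add]
        exact Submodule.add_mem _ hp hq
    · induction ht using Submodule.mul_induction_on' with
      | mem_mul_mem p hp q hq =>
        obtain ⟨b, rfl⟩ := hp
        rw [← mul_assoc]
        refine Submodule.mul_mem_mul ⟨ExteriorAlgebra.ι ℚ ⟨v, hv⟩ * b, ?_⟩ hq
        simp [hjV]
      | add p _ q _ hp hq =>
        rw [mul_add]
        exact Submodule.add_mem _ hp hq

open scoped TensorProduct in
/-- The products of elements of `ΛV` and `ΛU^odd` are independent modulo the ideal generated by
`U^even`, because the quotient maps to the graded tensor product of `ΛV` and `ΛU^odd`. -/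
theorem eq_zero_of_sum_mem_rightIdeal {U V : Submodule ℚ W} (hU : U.IsHomogeneous 𝒲)
    (hV : V.IsHomogeneous 𝒲) (hUV : IsCompl U V) (hVo : V ≤ oddGenerators 𝒲) {n : ℕ}
    (e : Basis (Fin n) ℚ (ExteriorAlgebra ℚ (U ⊓ oddGenerators 𝒲 : Submodule ℚ W)))
    (f : Fin n → ExteriorAlgebra ℚ V)
    (hf : ∑ i, ofExterior hVo (f i) * ofExterior inf_le_right (e i) ∈
      rightIdeal 𝒲 (U ⊓ evenGenerators 𝒲)) : f = 0 := by
  let Q₁ : QuadraticForm ℚ V := 0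
  let Q₂ : QuadraticForm ℚ (U ⊓ oddGenerators 𝒲 : Submodule ℚ W) := 0
  let pV : W →ₗ[ℚ] V := Submodule.projectionOnto V U hUV.symm
  let pU : W →ₗ[ℚ] (U ⊓ oddGenerators 𝒲 : Submodule ℚ W) :=
    Submodule.projectionOnto _ _ (isCompl_odd_part hU hUV)
  have hpV : ∀ u ∈ U, pV u = 0 := fun u hu =>
    (Submodule.projectionOnto_apply_eq_zero_iff _).2 hu
  have hpVV : ∀ v : V, pV v = v := fun v => Submodule.projectionOnto_apply_left hUV.symm v
  have hpU : ∀ w ∈ U ⊓ evenGenerators 𝒲 ⊔ V, pU w = 0 := fun u hu =>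
    (Submodule.projectionOnto_apply_eq_zero_iff _).2 hu
  have hpUU : ∀ u : (U ⊓ oddGenerators 𝒲 : Submodule ℚ W), pU u = u := fun u =>
    Submodule.projectionOnto_apply_left (isCompl_odd_part hU hUV) u
  have heven : evenGenerators 𝒲 ≤ U := fun w hw => by
    obtain ⟨v, hv, u, hu, rfl⟩ := Submodule.mem_sup.1 (even_le_sup hV hU hUV.symm hw)
    have : v = 0 := Submodule.disjoint_def.1 disjoint_even_odd v hv.2 (hVo hv.1)
    rw [this, zero_add]
    exact hu
  let P : FreeGCA 𝒲 →ₐ[ℚ] CliffordAlgebra (Q₁.prod Q₂) :=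
    lift ((CliffordAlgebra.ι (Q₁.prod Q₂)).comp (pV.prod pU)) (lift_condition
      (fun x hx y => by
        have : (pV.prod pU) x = 0 :=
          Prod.ext (hpV x (heven hx)) (hpU x (even_le_sup hU hV hUV hx))
        rw [LinearMap.comp_apply, this, map_zero, zero_mul, mul_zero])
      (fun x _ y _ => by
        refine eq_neg_of_add_eq_zero_left ?_
        rw [LinearMap.comp_apply, LinearMap.comp_apply, CliffordAlgebra.ι_mul_ι_add_swap]
        simp [QuadraticMap.polar, Q₁, Q₂]))
  let H := (CliffordAlgebra.ofProd Q₁ Q₂).comp P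
  have hH : ∀ w, H (ι 𝒲 w) = CliffordAlgebra.ofProd Q₁ Q₂ (CliffordAlgebra.ι _ (pV w, pU w)) :=
    fun w => by simp [H, P]
  have hHV : ∀ b, H (ofExterior hVo b) =
      GradedTensorProduct.includeLeft (CliffordAlgebra.evenOdd Q₁) (CliffordAlgebra.evenOdd Q₂) b := by
    intro b
    have : H.comp (ofExterior hVo) = GradedTensorProduct.includeLeft (CliffordAlgebra.evenOdd Q₁)
        (CliffordAlgebra.evenOdd Q₂) := by
      refine CliffordAlgebra.hom_ext (LinearMap.ext fun v => ?_)
      change H (ofExterior hVo (ExteriorAlgebra.ι ℚ v)) = _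
      rw [ofExterior_ι, hH, hpVV, hpU _ (Submodule.mem_sup_right v.2), CliffordAlgebra.ofProd_ι_mk,
        map_zero]
      exact add_eq_left.2 (map_zero (GradedTensorProduct.includeRight
        (CliffordAlgebra.evenOdd Q₁) (CliffordAlgebra.evenOdd Q₂)))
    exact AlgHom.congr_fun this b
  have hHU : ∀ m, H (ofExterior inf_le_right m) =
      GradedTensorProduct.includeRight (CliffordAlgebra.evenOdd Q₁) (CliffordAlgebra.evenOdd Q₂) m := by
    intro m
    have : H.comp (ofExterior inf_le_right) = GradedTensorProduct.includeRight
        (CliffordAlgebra.evenOdd Q₁) (CliffordAlgebra.evenOdd Q₂) := by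
      refine CliffordAlgebra.hom_ext (LinearMap.ext fun u => ?_)
      change H (ofExterior inf_le_right (ExteriorAlgebra.ι ℚ u)) = _
      rw [ofExterior_ι, hH, hpUU, hpV _ u.2.1, CliffordAlgebra.ofProd_ι_mk, map_zero]
      exact add_eq_right.2 (map_zero (GradedTensorProduct.includeLeft
        (CliffordAlgebra.evenOdd Q₁) (CliffordAlgebra.evenOdd Q₂)))
    exact AlgHom.congr_fun this m
  have hHI : rightIdeal 𝒲 (U ⊓ evenGenerators 𝒲) ≤ LinearMap.ker H.toLinearMap :=
    rightIdeal_le fun u hu a => by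
      rw [LinearMap.mem_ker, AlgHom.toLinearMap_apply, map_mul, hH, hpV u hu.1,
        hpU u (Submodule.mem_sup_left hu), ← Prod.zero_eq_mk, map_zero, map_zero, zero_mul]
  have h0 : H (∑ i, ofExterior hVo (f i) * ofExterior inf_le_right (e i)) = 0 := hHI hf
  rw [map_sum] at h0
  have h1 : ∀ i, H (ofExterior hVo (f i) * ofExterior inf_le_right (e i)) =
      GradedTensorProduct.of ℚ (CliffordAlgebra.evenOdd Q₁) (CliffordAlgebra.evenOdd Q₂)
        (f i ⊗ₜ e i) := fun i => by
    rw [map_mul, hHV, hHU]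
    exact GradedTensorProduct.tmul_one_mul_one_tmul _ _ (f i) (e i)
  simp only [h1, ← map_sum, EmbeddingLike.map_eq_zero_iff] at h0
  have h2 := TensorProduct.sum_tmul_basis_right_eq_zero e (Finsupp.equivFunOnFinite.symm f) (by
    rw [Finsupp.sum_fintype _ _ (by simp)]
    simpa using h0)
  exact funext fun i => DFunLike.congr_fun h2 i

/-- If the second stage of a two-stage minimal model is odd, then the cohomology of the quotient by
the even generators of the first stage has dimension at least `2 ^ dim V`. A basis `e` of `ΛU^odd`
identifies the quotient with a twisted tensor product `Fin n → ΛV`. -/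
theorem two_pow_finrank_le {U V : Submodule ℚ W} [FiniteDimensional ℚ W]
    (hmin : IsMinimalModel 𝒲 d) (htwo : IsTwoStage 𝒲 d U V) (hV : V ≤ oddGenerators 𝒲) {N : ℕ}
    (h : CohomologyBoundMod d (rightIdeal 𝒲 (U ⊓ evenGenerators 𝒲)) N) :
    2 ^ finrank ℚ V ≤ N := by
  have hd := hmin.toIsCDGADifferential
  set I := rightIdeal 𝒲 (U ⊓ evenGenerators 𝒲) with hI
  obtain ⟨n, e, hn, he⟩ :=
    exists_triangular_basis (K := ℚ) (C := (U ⊓ oddGenerators 𝒲 : Submodule ℚ W))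
  let y : V →ₗ[ℚ] ExteriorAlgebra ℚ (U ⊓ oddGenerators 𝒲 : Submodule ℚ W) :=
    (toExterior htwo.homogeneous_left htwo.homogeneous_right htwo.isCompl).toLinearMap.comp
      (d.comp ((ι 𝒲).comp V.subtype))
  let φ : Fin n → Fin n → Module.Dual ℚ V := fun i j =>
    (e.coord i).comp ((LinearMap.mulRight ℚ (e j)).comp y)
  let E : Fin n → Fin n → ExteriorAlgebra ℚ V →ₗ[ℚ] ExteriorAlgebra ℚ V := fun i j =>
    CliffordAlgebra.contractLeft (φ i j)
  let D : (Fin n → ExteriorAlgebra ℚ V) →ₗ[ℚ] (Fin n → ExteriorAlgebra ℚ V) :=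
    LinearMap.pi fun i => ∑ j, (E i j).comp (LinearMap.proj j)
  let Ψ : (Fin n → ExteriorAlgebra ℚ V) →ₗ[ℚ] FreeGCA 𝒲 :=
    ∑ i, (LinearMap.mulRight ℚ (ofExterior inf_le_right (e i))).comp
      ((ofExterior hV).toLinearMap.comp (LinearMap.proj i))
  have hD : ∀ f i, D f i = ∑ j, E i j (f j) := fun f i => by simp [D]
  have hΨ : ∀ f, Ψ f = ∑ i, ofExterior hV (f i) * ofExterior inf_le_right (e i) := fun f => by
    simp [Ψ]
  have hdI : I ≤ I.comap d := rightIdeal_le fun u hu a => by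
    rw [Submodule.mem_comap, hd.even_mul hu.2, htwo.d_left u hu.1, zero_mul, zero_add]
    exact ι_mul_mem_rightIdeal hu _
  have hcomp : ∀ f, d (Ψ f) - Ψ (D f) ∈ I := fun f => by
    have h1 : d (Ψ f) - Ψ (D f) = ∑ j, (d (ofExterior hV (f j) * ofExterior inf_le_right (e j)) -
        ∑ i, ofExterior hV (E i j (f j)) * ofExterior inf_le_right (e i)) := by
      rw [hΨ, hΨ, map_sum, Finset.sum_sub_distrib, Finset.sum_comm]
      simp only [hD, map_sum, Finset.sum_mul]
    rw [h1]
    exact I.sum_mem fun j _ => d_mul_sub_sum_mem hmin htwo hV e j (fun i => φ i j)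
      (fun i v => rfl) (f j)
  have hinj : ∀ f, Ψ f ∈ I → f = 0 := fun f hf =>
    eq_zero_of_sum_mem_rightIdeal htwo.homogeneous_left htwo.homogeneous_right htwo.isCompl hV e f
      (by rwa [hΨ] at hf)
  have hsurj : I ⊔ LinearMap.range Ψ = ⊤ := by
    refine eq_top_iff.2 ((rightIdeal_sup_mul_eq_top htwo.homogeneous_left htwo.isCompl hV).ge.trans
      (sup_le_sup_left (Submodule.mul_le.2 ?_) _))
    rintro _ ⟨b, rfl⟩ _ ⟨m, rfl⟩
    refine ⟨fun i => e.repr m i • b, ?_⟩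
    have hm : ofExterior inf_le_right m =
        ∑ i, e.repr m i • ofExterior (inf_le_right : U ⊓ oddGenerators 𝒲 ≤ _) (e i) := by
      conv_lhs => rw [← e.sum_repr m]
      rw [map_sum]
      exact Finset.sum_congr rfl fun i _ => map_smul _ _ _
    rw [hΨ, AlgHom.toLinearMap_apply, AlgHom.toLinearMap_apply, hm, Finset.mul_sum]
    exact Finset.sum_congr rfl fun i _ => by rw [map_smul, smul_mul_assoc, mul_smul_comm]
  have hDD : ∀ f, D (D f) = 0 := fun f => hinj _ (by
    have h1 : Ψ (D (D f)) = -(d (Ψ (D f)) - Ψ (D (D f))) - d (d (Ψ f) - Ψ (D f)) := by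
      rw [map_sub, hd.sq_zero]; abel
    rw [h1]
    exact I.sub_mem (I.neg_mem (hcomp _)) (hdI (hcomp f)))
  have := finiteDimensional_exteriorAlgebra (K := ℚ) (C := V)
  rw [← finrank_exteriorAlgebra (K := ℚ)]
  refine (h.of_comparison hdI hcomp hinj hsurj).finrank_le_of_anticommute hn (E := E)
    (fun i j hij => ?_) (fun i j k l x => CliffordAlgebra.contractLeft_comm _ _ x) hD hDD
  have hφ0 : φ i j = 0 := LinearMap.ext fun v => he _ (toExterior_d_mem hmin htwo v) i j hij
  simp only [E, hφ0, map_zero]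

end Koszul

end FreeGCA

end

theorem mainTheorem1 {W : Type*} [AddCommGroup W] [Module ℚ W] (𝒲 : ℕ → Submodule ℚ W)
    [DirectSum.Decomposition 𝒲] (d : FreeGCA 𝒲 →ₗ[ℚ] FreeGCA 𝒲) (U V : Submodule ℚ W)
    (hmin : IsMinimalModel 𝒲 d) (hell : IsEllipticModel 𝒲 d) (htwo : IsTwoStage 𝒲 d U V) :
    (2 : ℚ) ^ ((Module.finrank ℚ V : ℤ) - (Module.finrank ℚ (evenPart 𝒲 U) : ℤ)) ≤
      (Module.finrank ℚ (ModelCohomology 𝒲 d) : ℚ) := by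
  have := hell.finite_generators
  have := hell.finite_cohomology
  have h := cohomologyBoundMod_finrank d
  have hV := FreeGCA.right_le_oddGenerators hmin htwo h
  have h2 : 2 ^ Module.finrank ℚ V ≤
      2 ^ Module.finrank ℚ (evenPart 𝒲 U) * Module.finrank ℚ (ModelCohomology 𝒲 d) :=
    FreeGCA.two_pow_finrank_le hmin htwo hV (FreeGCA.cohomologyBoundMod_even hmin htwo h)
  rw [zpow_sub₀ two_ne_zero, zpow_natCast, zpow_natCast, div_le_iff₀ (by positivity), mul_comm]
  exact_mod_cast h2
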